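/- For a prime $p$ write $G_p=\mathrm{SL}_2(\mathbb{Z}/p\mathbb{Z})$; for a finite set $X$ let $|X|$ denote its cardinality, and for $A\subset G_p$ let $A\cdot A\cdot A=\{xyz : x,y,z\in A\}$ and $A^{-1}=\{x^{-1}: x\in A\}$. (a) For every real $\delta>0$ there are real numbers $c>0$ and $\varepsilon>0$, depending only on $\delta$, such that for every prime $p$ and every subset $A\subset G_p$ that is not contained in any proper subgroup of $G_p$ and satisfies $|A|<p^{3-\delta}$, $$|A\cdot A\cdot A|>c\,|A|^{1+\varepsilon}.$$ (b) For every real $\delta>0$ there is an integer $k>0$, depending only on $\delta$, such that for every prime $p$ and every subset $A\subset G_p$ that is not contained in any proper subgroup of $G_p$ and satisfies $|A|>p^{\delta}$, every element of $G_p$ can be expressed as a product of at most $k$ elements of $A\cup A^{-1}$. -/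

import Mathlib

open scoped Pointwise

open scoped MatrixGroups

/-! Part (a) is proved by playing trace fibres against centralizers. Replace `A` by the symmetric
set `B = {1} ∪ A ∪ A⁻¹`. If `A` has tripling constant `K`, every fixed power of `B` has size at most
`K ^ O(1) * |A|` (`card_symmetrized_pow_le`), so it suffices to compare `|B|` with `N = |B ^ 26|`.

Let `S` be the set of elements of `B ^ 6` with trace `t`, where `t` is not `0`, `2` or `-2`. Given
`s₀ * s₁` and `s₁ * s₂` with factors in `S`, the matrix `s₁⁻¹` lies on a line and on the quadric
`det = 1`, which leaves at most two choices unless `s₀` and `s₁` are degenerate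
(`card_good_triples_le`). Degenerate pairs essentially share an eigenvector, and few elements fix a
given vector (`card_fixing_sq_le`). Hence `|S| ≪ N ^ (2/3)` (`card_trace_fibre_le`).

Conjugating `g` by `B` stays in a trace fibre, so the centralizer of `g` has `≫ |B| / N ^ (2/3)`
elements in `B ^ 2`. If some such centralizer is bounded, `|B| ≪ N ^ (2/3)`. Otherwise richness
passes along words in the generators to all conjugates of `g` (`le_card_centralizer_conj`), and
counting over the whole group makes `N` large in terms of `q` (`growth_trichotomy`). So either `K`
is at least a power of `|A|`, or `|A|` is at least `p ^ 3` up to a power of `K`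
(`exists_tripling_bound`).

For part (b), boundedly many triplings reach size `p ^ (14/5)`. At that size pigeonhole gives many
unipotent and many triangular elements; conjugation multiplies their entries, an incidence bound
(`exists_incidence`) makes sums of two products cover the field, and four unipotent factors give
every matrix (`pow_eq_univ_of_card`). -/

section MatrixIdentities

/-! ### Identities for two by two matrices. -/

variable {F : Type*} [Field F]

/-- In dimension two, the matrices orthogonal to `1`, `X`, `Y` for the trace form are the multiples
of the commutator of `X` and `Y`. -/
theorem exists_eq_smul_commutator {X Y N : Matrix (Fin 2) (Fin 2) F} (h0 : N.trace = 0)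
    (hX : (X * N).trace = 0) (hY : (Y * N).trace = 0) (hne : X * Y - Y * X ≠ 0) :
    ∃ τ : F, N = τ • (X * Y - Y * X) := by
  simp only [Matrix.trace_fin_two, Matrix.mul_apply, Fin.sum_univ_two] at h0 hX hY
  have key : ∀ i j k l, N i j * (X * Y - Y * X) k l = (X * Y - Y * X) i j * N k l := by
    simp only [Fin.forall_fin_two, Matrix.sub_apply, Matrix.mul_apply, Fin.sum_univ_two]
    have h1 : N 1 1 = - N 0 0 := by linear_combination h0
    rw [h1] at hX hY ⊢
    refine ⟨⟨⟨⟨?_, ?_⟩, ?_, ?_⟩, ⟨?_, ?_⟩, ?_, ?_⟩, ⟨⟨?_, ?_⟩, ?_, ?_⟩, ⟨?_, ?_⟩, ?_, ?_⟩ <;> grind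
  obtain ⟨k, l, hkl⟩ : ∃ k l, (X * Y - Y * X) k l ≠ 0 := by
    by_contra! h
    exact hne (by ext i j; simpa using h i j)
  refine ⟨N k l / (X * Y - Y * X) k l, ?_⟩
  ext i j
  rw [Matrix.smul_apply, smul_eq_mul, div_mul_eq_mul_div, eq_div_iff hkl, key i j k l, mul_comm]

/-- For determinants `1`, equal traces `t` and product trace `T` the right side is `(2 - T) * (2 + T
- t ^ 2)`; this is how a nondegenerate pair excludes `T = 2`. -/
theorem det_commutator (X Y : Matrix (Fin 2) (Fin 2) F) :
    (X * Y - Y * X).det = 4 * X.det * Y.det - X.trace ^ 2 * Y.det - Y.trace ^ 2 * X.det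
      - (X * Y).trace ^ 2 + X.trace * Y.trace * (X * Y).trace := by
  simp only [Matrix.det_fin_two, Matrix.trace_fin_two, Matrix.sub_apply, Matrix.mul_apply,
    Fin.sum_univ_two]
  ring

theorem trace_mul_commutator_left (X Y : Matrix (Fin 2) (Fin 2) F) :
    (X * (X * Y - Y * X)).trace = 0 := by
  simp only [Matrix.trace_fin_two, Matrix.sub_apply, Matrix.mul_apply, Fin.sum_univ_two]
  ring

theorem det_add_smul (Z N : Matrix (Fin 2) (Fin 2) F) (hN : N.trace = 0) (τ : F) :
    (Z + τ • N).det = Z.det - τ * (Z * N).trace + τ ^ 2 * N.det := by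
  simp only [Matrix.det_fin_two, Matrix.trace_fin_two, Matrix.add_apply, Matrix.smul_apply,
    Matrix.mul_apply, Fin.sum_univ_two, smul_eq_mul] at *
  have h1 : N 1 1 = - N 0 0 := by linear_combination hN
  rw [h1]
  ring

/-- A line meets a level set of the determinant in at most two points, unless it lies on it. -/
theorem det_commutator_eq_zero_of_three_points {u v z₁ z₂ z₃ : Matrix (Fin 2) (Fin 2) F}
    (huv : u * v - v * u ≠ 0)
    (h₂ : z₂.trace = z₁.trace) (h₃ : z₃.trace = z₁.trace)
    (hu₂ : (u * z₂).trace = (u * z₁).trace) (hu₃ : (u * z₃).trace = (u * z₁).trace)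
    (hv₂ : (v * z₂).trace = (v * z₁).trace) (hv₃ : (v * z₃).trace = (v * z₁).trace)
    (hd₂ : z₂.det = z₁.det) (hd₃ : z₃.det = z₁.det)
    (h12 : z₁ ≠ z₂) (h13 : z₁ ≠ z₃) (h23 : z₂ ≠ z₃) :
    (u * z₁ - z₁ * u).det = 0 := by
  set N := u * v - v * u with hN
  have htr : N.trace = 0 := by rw [hN, Matrix.trace_sub, Matrix.trace_mul_comm, sub_self]
  obtain ⟨τ₂, hτ₂⟩ := exists_eq_smul_commutator (N := z₂ - z₁) (X := u) (Y := v)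
    (by rw [Matrix.trace_sub, h₂, sub_self])
    (by rw [mul_sub, Matrix.trace_sub, hu₂, sub_self])
    (by rw [mul_sub, Matrix.trace_sub, hv₂, sub_self]) huv
  obtain ⟨τ₃, hτ₃⟩ := exists_eq_smul_commutator (N := z₃ - z₁) (X := u) (Y := v)
    (by rw [Matrix.trace_sub, h₃, sub_self])
    (by rw [mul_sub, Matrix.trace_sub, hu₃, sub_self])
    (by rw [mul_sub, Matrix.trace_sub, hv₃, sub_self]) huv
  rw [← hN] at hτ₂ hτ₃
  have e₂ : z₂ = z₁ + τ₂ • N := by rw [← hτ₂]; abel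
  have e₃ : z₃ = z₁ + τ₃ • N := by rw [← hτ₃]; abel
  have n₂ : τ₂ ≠ 0 := by rintro rfl; exact h12 (by simp [e₂])
  have n₃ : τ₃ ≠ 0 := by rintro rfl; exact h13 (by simp [e₃])
  have n₂₃ : τ₂ ≠ τ₃ := by rintro rfl; exact h23 (by rw [e₂, e₃])
  rw [e₂, det_add_smul _ _ htr] at hd₂
  rw [e₃, det_add_smul _ _ htr] at hd₃
  have q₂ : τ₂ * N.det = (z₁ * N).trace := mul_left_cancel₀ n₂ (by linear_combination hd₂)
  have q₃ : τ₃ * N.det = (z₁ * N).trace := mul_left_cancel₀ n₃ (by linear_combination hd₃)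
  have hdet : N.det = 0 := by
    have : (τ₂ - τ₃) * N.det = 0 := by linear_combination q₂ - q₃
    exact (mul_eq_zero.1 this).resolve_left (sub_ne_zero.2 n₂₃)
  have hz : (z₁ * N).trace = 0 := by rw [← q₂, hdet, mul_zero]
  by_cases hc : u * z₁ - z₁ * u = 0
  · rw [hc]; simp
  -- The direction `N` is now orthogonal to `1`, `u` and `z₁`, so it is also a multiple of the
  -- commutator of `u` and `z₁`, and its determinant vanishes.
  obtain ⟨τ, hτ⟩ := exists_eq_smul_commutator htr (trace_mul_commutator_left u v) hz hc
  have hτ0 : τ ≠ 0 := by rintro rfl; exact huv (by simpa using hτ)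
  rw [hτ, Matrix.det_smul] at hdet
  simpa [hτ0] using hdet

/-- The centralizer of a non-scalar two by two matrix. -/
theorem exists_eq_add_smul_of_commute {u v : Matrix (Fin 2) (Fin 2) F}
    (hu : ∀ c : F, u ≠ c • 1) (h : u * v = v * u) : ∃ α β : F, v = α • 1 + β • u := by
  have h00 := congrFun₂ h 0 0
  have h01 := congrFun₂ h 0 1
  have h10 := congrFun₂ h 1 0
  simp only [Matrix.mul_apply, Fin.sum_univ_two] at h00 h01 h10
  suffices ∃ α β : F, v 0 0 = α + β * u 0 0 ∧ v 0 1 = β * u 0 1 ∧ v 1 0 = β * u 1 0 ∧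
      v 1 1 = α + β * u 1 1 by
    obtain ⟨α, β, h1, h2, h3, h4⟩ := this
    refine ⟨α, β, ?_⟩
    ext i j
    fin_cases i <;> fin_cases j <;> simp [h1, h2, h3, h4]
  by_cases hb : u 0 1 = 0
  · by_cases hc : u 1 0 = 0
    · have hd : u 0 0 - u 1 1 ≠ 0 := by
        intro hd
        refine hu (u 0 0) ?_
        ext i j
        fin_cases i <;> fin_cases j <;> simp [hb, hc]
        linear_combination -hd
      refine ⟨v 0 0 - (v 0 0 - v 1 1) / (u 0 0 - u 1 1) * u 0 0,
        (v 0 0 - v 1 1) / (u 0 0 - u 1 1), by ring, ?_, ?_, ?_⟩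
      · rw [hb] at h01 ⊢
        have : (u 0 0 - u 1 1) * v 0 1 = 0 := by linear_combination h01
        simpa [hd] using this
      · rw [hc] at h10 ⊢
        have : (u 0 0 - u 1 1) * v 1 0 = 0 := by linear_combination -h10
        simpa [hd] using this
      · field_simp; ring
    · refine ⟨v 0 0 - v 1 0 / u 1 0 * u 0 0, v 1 0 / u 1 0, by ring, ?_, ?_, ?_⟩ <;>
        field_simp <;> grind
  · refine ⟨v 0 0 - v 0 1 / u 0 1 * u 0 0, v 0 1 / u 0 1, by ring, ?_, ?_, ?_⟩ <;>
      field_simp <;> grind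

end MatrixIdentities

/-! ### Products of elements of a trace fibre. -/

section TraceFibres

variable {F : Type*} [Field F]

theorem Matrix.SpecialLinearGroup.trace_inv_fin_two (g : SL(2, F)) :
    (g⁻¹).1.trace = g.1.trace := by
  rw [Matrix.SpecialLinearGroup.coe_inv, Matrix.adjugate_fin_two, Matrix.trace_fin_two,
    Matrix.trace_fin_two]
  simp [add_comm]

theorem Matrix.SpecialLinearGroup.trace_conj (g x : SL(2, F)) :
    (x * g * x⁻¹).1.trace = g.1.trace := by
  rw [Matrix.SpecialLinearGroup.coe_mul, Matrix.trace_mul_comm,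
    ← Matrix.SpecialLinearGroup.coe_mul]
  simp

theorem Matrix.SpecialLinearGroup.inv_eq_trace_sub (g : SL(2, F)) :
    (g⁻¹).1 = g.1.trace • (1 : Matrix (Fin 2) (Fin 2) F) - g.1 := by
  rw [Matrix.SpecialLinearGroup.SL2_inv_expl]
  ext i j
  fin_cases i <;> fin_cases j <;> simp [Matrix.trace_fin_two]

theorem det_one_add_smul (u : Matrix (Fin 2) (Fin 2) F) (α β : F) :
    (α • (1 : Matrix (Fin 2) (Fin 2) F) + β • u).det
      = α ^ 2 + α * β * u.trace + β ^ 2 * u.det := by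
  simp [Matrix.det_fin_two, Matrix.trace_fin_two]
  ring

theorem commute_of_eq_smul_inv {s₀ s₁ : SL(2, F)} {c : F} (h : (s₀ * s₁).1 = c • 1) :
    s₀.1 * s₁.1 = s₁.1 * s₀.1 := by
  have h1 : s₀.1 = c • (s₁⁻¹).1 := by
    have : s₀ = s₀ * s₁ * s₁⁻¹ := by group
    conv_lhs => rw [this]
    rw [Matrix.SpecialLinearGroup.coe_mul, h]
    simp
  rw [h1, smul_mul_assoc, mul_smul_comm, ← Matrix.SpecialLinearGroup.coe_mul,
    ← Matrix.SpecialLinearGroup.coe_mul]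
  simp

theorem trace_mul_ne_two {s₀ s₁ : SL(2, F)} {t : F} (h₀ : s₀.1.trace = t) (h₁ : s₁.1.trace = t)
    (hD : (s₀.1 * s₁.1 - s₁.1 * s₀.1).det ≠ 0) : (s₀ * s₁).1.trace ≠ 2 := by
  intro h
  apply hD
  rw [det_commutator, h₀, h₁, ← Matrix.SpecialLinearGroup.coe_mul, h, s₀.2, s₁.2]
  ring

/-- If they commuted, `s₁ * s₂` would be `α + β * (s₀ * s₁)`. Multiplying by `s₁⁻¹` and taking
traces gives `α + β = 1`, and then determinants give `α * (1 - α) * (tr (s₀ * s₁) - 2) = 0`. The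
roots `α = 0` and `α = 1` are the two excluded products. -/
theorem mul_commutator_ne_zero {s₀ s₁ s₂ : SL(2, F)} {t : F} (ht : t ≠ 0)
    (h₀ : s₀.1.trace = t) (h₁ : s₁.1.trace = t) (h₂ : s₂.1.trace = t)
    (hD : (s₀.1 * s₁.1 - s₁.1 * s₀.1).det ≠ 0) (hne1 : s₁ * s₂ ≠ 1)
    (hne2 : s₁ * s₂ ≠ s₀ * s₁) :
    (s₀ * s₁).1 * (s₁ * s₂).1 - (s₁ * s₂).1 * (s₀ * s₁).1 ≠ 0 := by
  intro h
  have hns : ∀ c : F, (s₀ * s₁).1 ≠ c • 1 := by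
    intro c hc
    apply hD
    rw [commute_of_eq_smul_inv hc]
    simp
  obtain ⟨α, β, hv⟩ := exists_eq_add_smul_of_commute hns (sub_eq_zero.1 h)
  have hs2 : s₂.1 = α • (s₁⁻¹).1 + β • (s₁⁻¹ * s₀ * s₁).1 := by
    have e : s₂ = s₁⁻¹ * (s₁ * s₂) := by group
    rw [e, Matrix.SpecialLinearGroup.coe_mul, hv, mul_add, mul_smul_comm, mul_smul_comm, mul_one,
      ← Matrix.SpecialLinearGroup.coe_mul, mul_assoc]
  have htr := congrArg Matrix.trace hs2
  have hc : (s₁⁻¹ * s₀ * s₁).1.trace = t := by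
    rw [← h₀]
    simpa using Matrix.SpecialLinearGroup.trace_conj s₀ s₁⁻¹
  rw [Matrix.trace_add, Matrix.trace_smul, Matrix.trace_smul, hc,
    Matrix.SpecialLinearGroup.trace_inv_fin_two, h₁, h₂, smul_eq_mul, smul_eq_mul] at htr
  have hαβ : β = 1 - α := mul_right_cancel₀ ht (by linear_combination -htr)
  have hdet := congrArg Matrix.det hv
  rw [det_one_add_smul, (s₁ * s₂).2, (s₀ * s₁).2, hαβ] at hdet
  have h2 := trace_mul_ne_two h₀ h₁ hD
  have : α * ((1 - α) * ((s₀ * s₁).1.trace - 2)) = 0 := by linear_combination -hdet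
  rcases mul_eq_zero.1 this with hα | hα
  · apply hne2
    apply Subtype.ext
    rw [hv, hαβ, hα]
    simp
  · rcases mul_eq_zero.1 hα with hα | hα
    · apply hne1
      apply Subtype.ext
      rw [hv, hαβ, hα, ← sub_eq_zero.1 hα]
      simp
    · exact h2 (sub_eq_zero.1 hα)

/-- Left multiplication by `s₁` preserves determinants and turns the first commutator into minus the
second. -/
theorem det_commutator_mul_inv (s₀ s₁ : SL(2, F)) :
    ((s₀ * s₁).1 * (s₁⁻¹).1 - (s₁⁻¹).1 * (s₀ * s₁).1).det
      = (s₀.1 * s₁.1 - s₁.1 * s₀.1).det := by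
  have e : s₁.1 * (((s₀ * s₁).1 * (s₁⁻¹).1 - (s₁⁻¹).1 * (s₀ * s₁).1))
      = -(s₀.1 * s₁.1 - s₁.1 * s₀.1) := by
    have e1 : s₁ * (s₀ * s₁ * s₁⁻¹) = s₁ * s₀ := by group
    have e2 : s₁ * (s₁⁻¹ * (s₀ * s₁)) = s₀ * s₁ := by group
    rw [mul_sub]
    simp only [← Matrix.SpecialLinearGroup.coe_mul]
    rw [e1, e2, neg_sub]
  have := congrArg Matrix.det e
  rwa [Matrix.det_mul, s₁.2, one_mul, Matrix.det_neg, Fintype.card_fin, neg_one_sq, one_mul] at this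

/-- The triples `(s₀, s₁, s₂)` in a trace fibre are determined up to two choices by the products
`s₀ * s₁` and `s₁ * s₂`, outside a degenerate set. -/
theorem card_good_triples_le [DecidableEq F] {S : Finset SL(2, F)} {t : F} {m : ℕ} (ht : t ≠ 0)
    (hS : ∀ s ∈ S, s.1.trace = t)
    (hm : ∀ s₀ ∈ S, (S.filter fun s₁ ↦ (s₀.1 * s₁.1 - s₁.1 * s₀.1).det = 0).card ≤ m) :
    S.card * ((S.card - m) * (S.card - 2)) ≤ 2 * (S * S).card ^ 2 := by
  classical
  let T : Finset (Σ _ : SL(2, F), Σ _ : SL(2, F), SL(2, F)) :=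
    S.sigma fun s₀ ↦ (S.filter fun s₁ ↦ (s₀.1 * s₁.1 - s₁.1 * s₀.1).det ≠ 0).sigma fun s₁ ↦
      S.filter fun s₂ ↦ s₁ * s₂ ≠ 1 ∧ s₁ * s₂ ≠ s₀ * s₁
  have hT : S.card * ((S.card - m) * (S.card - 2)) ≤ T.card := by
    rw [Finset.card_sigma, ← smul_eq_mul]
    refine Finset.card_nsmul_le_sum _ _ _ fun s₀ hs₀ ↦ ?_
    rw [Finset.card_sigma]
    have h1 : S.card - m ≤ (S.filter fun s₁ ↦ (s₀.1 * s₁.1 - s₁.1 * s₀.1).det ≠ 0).card := by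
      have := hm s₀ hs₀
      have := Finset.card_filter_add_card_filter_not (s := S)
        (fun s₁ ↦ (s₀.1 * s₁.1 - s₁.1 * s₀.1).det = 0)
      simp only [ne_eq]
      omega
    refine (Nat.mul_le_mul_right _ h1).trans ?_
    rw [← smul_eq_mul]
    refine Finset.card_nsmul_le_sum _ _ _ fun s₁ hs₁ ↦ ?_
    have h2 : S \ {s₁⁻¹, s₁⁻¹ * (s₀ * s₁)} ⊆
        S.filter fun s₂ ↦ s₁ * s₂ ≠ 1 ∧ s₁ * s₂ ≠ s₀ * s₁ := by
      intro s hs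
      simp only [Finset.mem_sdiff, Finset.mem_insert, Finset.mem_singleton, not_or] at hs
      refine Finset.mem_filter.2 ⟨hs.1, fun h ↦ hs.2.1 (eq_inv_of_mul_eq_one_right h), fun h ↦
        hs.2.2 ?_⟩
      rw [← h]
      group
    refine le_trans ?_ (Finset.card_le_card h2)
    exact (Nat.sub_le_sub_left Finset.card_le_two _).trans (Finset.le_card_sdiff _ _)
  refine hT.trans ?_
  rw [sq, ← Finset.card_product]
  let f : (Σ _ : SL(2, F), Σ _ : SL(2, F), SL(2, F)) → SL(2, F) × SL(2, F) :=
    fun x ↦ (x.1 * x.2.1, x.2.1 * x.2.2)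
  refine Finset.card_le_mul_card_image_of_maps_to (f := f) ?_ 2 ?_
  · rintro ⟨s₀, s₁, s₂⟩ h
    simp only [T, Finset.mem_sigma, Finset.mem_filter] at h
    exact Finset.mk_mem_product (Finset.mul_mem_mul h.1 h.2.1.1) (Finset.mul_mem_mul h.2.1.1 h.2.2.1)
  · rintro ⟨u, v⟩ -
    by_contra! hcard
    obtain ⟨x, hx, y, hy, z, hz, hxy, hxz, hyz⟩ := Finset.two_lt_card.1 hcard
    -- A triple over `(u, v)` is determined by `z = s₁⁻¹`, which satisfies the linear equations `tr
    -- z = tr (u * z) = tr (v * z) = t`. Three triples would be three points of a line on the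
    -- quadric.
    have hsol : ∀ x ∈ T.filter (f · = (u, v)), x = ⟨u * x.2.1⁻¹, x.2.1, x.2.1⁻¹ * v⟩ ∧
        (x.2.1⁻¹).1.trace = t ∧ (u.1 * (x.2.1⁻¹).1).trace = t ∧ (v.1 * (x.2.1⁻¹).1).trace = t := by
      rintro ⟨s₀, s₁, s₂⟩ h
      simp only [T, f, Finset.mem_sigma, Finset.mem_filter, Prod.mk.injEq] at h
      obtain ⟨⟨hs₀, ⟨hs₁, -⟩, hs₂, -⟩, rfl, rfl⟩ := h
      refine ⟨by simp, ?_, ?_, ?_⟩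
      · rw [Matrix.SpecialLinearGroup.trace_inv_fin_two, hS _ hs₁]
      · rw [← Matrix.SpecialLinearGroup.coe_mul]
        simpa using hS _ hs₀
      · rw [← Matrix.SpecialLinearGroup.coe_mul, Matrix.SpecialLinearGroup.trace_conj, hS _ hs₂]
    have hne : ∀ x ∈ T.filter (f · = (u, v)), ∀ y ∈ T.filter (f · = (u, v)), x ≠ y →
        (x.2.1⁻¹).1 ≠ (y.2.1⁻¹).1 := by
      intro x hx y hy hxy h
      have h' : x.2.1 = y.2.1 := inv_injective (Subtype.ext h)
      apply hxy
      rw [(hsol x hx).1, (hsol y hy).1, h']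
    obtain ⟨-, hx1, hx2, hx3⟩ := hsol x hx
    obtain ⟨-, hy1, hy2, hy3⟩ := hsol y hy
    obtain ⟨-, hz1, hz2, hz3⟩ := hsol z hz
    have n12 := hne x hx y hy hxy
    have n13 := hne x hx z hz hxz
    have n23 := hne y hy z hz hyz
    obtain ⟨s₀, s₁, s₂⟩ := x
    simp only [T, f, Finset.mem_sigma, Finset.mem_filter, Prod.mk.injEq] at hx
    obtain ⟨⟨hs₀, ⟨hs₁, hD⟩, hs₂, hne1, hne2⟩, rfl, rfl⟩ := hx
    have huv := mul_commutator_ne_zero ht (hS _ hs₀) (hS _ hs₁) (hS _ hs₂) hD hne1 hne2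
    have := det_commutator_eq_zero_of_three_points huv (hy1.trans hx1.symm) (hz1.trans hx1.symm)
      (hy2.trans hx2.symm) (hz2.trans hx2.symm) (hy3.trans hx3.symm) (hz3.trans hx3.symm)
      (by rw [(y.2.1⁻¹).2, (s₁⁻¹).2]) (by rw [(z.2.1⁻¹).2, (s₁⁻¹).2]) n12 n13 n23
    rw [det_commutator_mul_inv] at this
    exact hD this

end TraceFibres

/-! ### Centralizers of regular semisimple elements. -/

section Centralizers

variable {F : Type*} [Field F]

theorem ne_smul_one_of_trace_sq_ne_four {g : SL(2, F)} (ht : g.1.trace ^ 2 ≠ 4) (c : F) :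
    g.1 ≠ c • 1 := by
  intro h
  apply ht
  have h1 := g.2
  rw [h] at h1 ⊢
  rw [Matrix.det_fin_two] at h1
  simp only [Matrix.smul_apply, Matrix.one_apply_eq, smul_eq_mul, mul_one, Matrix.one_apply_ne,
    ne_eq, zero_ne_one, one_ne_zero, not_false_eq_true, mul_zero, sub_zero] at h1
  rw [Matrix.trace_fin_two]
  simp only [Matrix.smul_apply, Matrix.one_apply_eq, smul_eq_mul, mul_one]
  linear_combination 4 * h1

/-- Both elements lie in the algebra `F[g]`, where trace and determinant fix the coefficient of `g`
up to sign; the sign change is inversion. -/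
theorem eq_or_eq_inv_of_commute (h2 : (2 : F) ≠ 0) {g h k : SL(2, F)} (ht : g.1.trace ^ 2 ≠ 4)
    (hh : g * h = h * g) (hk : g * k = k * g) (htr : h.1.trace = k.1.trace) :
    h = k ∨ h = k⁻¹ := by
  have hg := ne_smul_one_of_trace_sq_ne_four ht
  obtain ⟨α, β, hh'⟩ := exists_eq_add_smul_of_commute hg (congrArg Subtype.val hh)
  obtain ⟨γ, δ, hk'⟩ := exists_eq_add_smul_of_commute hg (congrArg Subtype.val hk)
  have tr1 : h.1.trace = 2 * α + β * g.1.trace := by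
    rw [hh']; simp [Matrix.trace_fin_two]; ring
  have tr2 : k.1.trace = 2 * γ + δ * g.1.trace := by
    rw [hk']; simp [Matrix.trace_fin_two]; ring
  have d1 := h.2
  have d2 := k.2
  rw [hh', det_one_add_smul, g.2] at d1
  rw [hk', det_one_add_smul, g.2] at d2
  rw [tr1, tr2] at htr
  have hβ : (g.1.trace ^ 2 - 4) * ((β - δ) * (β + δ)) = 0 := by
    linear_combination (2 * α + β * g.1.trace + 2 * γ + δ * g.1.trace) * htr - 4 * d1 + 4 * d2
  rcases mul_eq_zero.1 ((mul_eq_zero.1 hβ).resolve_left (sub_ne_zero.2 ht)) with h' | h'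
  · left
    have e1 : β = δ := sub_eq_zero.1 h'
    have e2 : α = γ := mul_left_cancel₀ h2 (by rw [e1] at htr; linear_combination htr)
    apply Subtype.ext
    rw [hh', hk', e1, e2]
  · right
    have e1 : β = -δ := eq_neg_of_add_eq_zero_left h'
    have e2 : α = k.1.trace - γ := mul_left_cancel₀ h2 (by
      rw [e1] at htr; rw [tr2]; linear_combination htr)
    apply Subtype.ext
    have e3 : δ • g.1 = k.1 - γ • 1 := by rw [hk']; abel
    rw [Matrix.SpecialLinearGroup.inv_eq_trace_sub, hh', e2, e1, sub_smul, neg_smul, e3]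
    abel

end Centralizers

/-! ### Common eigenvectors of two matrices. -/

section Eigenvectors

variable {F : Type*} [Field F]

theorem eq_smul_of_cross_eq_zero {w v : Fin 2 → F} (hw : w ≠ 0)
    (h : w 0 * v 1 - w 1 * v 0 = 0) : ∃ c : F, v = c • w := by
  by_cases h0 : w 0 = 0
  · have h1 : w 1 ≠ 0 := by
      intro h1
      apply hw
      ext i
      fin_cases i <;> simp [h0, h1]
    refine ⟨v 1 / w 1, ?_⟩
    have : v 0 = 0 := by
      rw [h0] at h
      simpa [h1] using h
    ext i
    fin_cases i
    · simp [h0, this]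
    · simp [h1]
  · refine ⟨v 0 / w 0, ?_⟩
    ext i
    fin_cases i
    · simp [h0]
    · simp
      field_simp
      linear_combination h

theorem eq_of_mulVec_eq {X Y : Matrix (Fin 2) (Fin 2) F} {w v : Fin 2 → F}
    (hwv : w 0 * v 1 - w 1 * v 0 ≠ 0) (hw : X.mulVec w = Y.mulVec w)
    (hv : X.mulVec v = Y.mulVec v) : X = Y := by
  ext i j
  have e1 := congrFun hw i
  have e2 := congrFun hv i
  simp only [Matrix.mulVec, dotProduct, Fin.sum_univ_two] at e1 e2
  refine mul_right_cancel₀ hwv ?_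
  fin_cases j
  · simp only [Fin.zero_eta]
    linear_combination v 1 * e1 - w 1 * e2
  · simp only [Fin.mk_one]
    linear_combination w 0 * e2 - v 0 * e1

/-- The commutator `N` has rank one and trace zero. Orthogonality of `X` and `Y` to `N` says exactly
that both preserve its image, so a nonzero column serves. -/
theorem exists_common_eigenvector {X Y : Matrix (Fin 2) (Fin 2) F}
    (hdet : (X * Y - Y * X).det = 0) (hne : X * Y - Y * X ≠ 0) :
    ∃ w : Fin 2 → F, w ≠ 0 ∧ (∃ c : F, X.mulVec w = c • w) ∧ ∃ c : F, Y.mulVec w = c • w := by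
  set N := X * Y - Y * X with hN
  have htr : N.trace = 0 := by rw [hN, Matrix.trace_sub, Matrix.trace_mul_comm, sub_self]
  have hX : (X * N).trace = 0 := trace_mul_commutator_left X Y
  have hY : (Y * N).trace = 0 := by
    have : N = -(Y * X - X * Y) := by rw [hN, neg_sub]
    rw [this, mul_neg, Matrix.trace_neg, trace_mul_commutator_left, neg_zero]
  obtain ⟨j, hj⟩ : ∃ j, N.col j ≠ 0 := by
    by_contra! h
    exact hne (by ext i j; simpa using congrFun (h j) i)
  have key : ∀ Z : Matrix (Fin 2) (Fin 2) F, (Z * N).trace = 0 →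
      ∃ c : F, Z.mulVec (N.col j) = c • N.col j := by
    intro Z hZ
    apply eq_smul_of_cross_eq_zero hj
    simp only [Matrix.trace_fin_two, Matrix.det_fin_two, Matrix.mul_apply, Fin.sum_univ_two,
      Matrix.mulVec, dotProduct, Matrix.col_apply] at htr hZ hdet ⊢
    have h1 : N 1 1 = - N 0 0 := by linear_combination htr
    rw [h1] at hZ hdet
    fin_cases j
    · simp only [Fin.zero_eta]
      linear_combination -N 1 0 * hZ - Z 1 0 * hdet
    · simp only [Fin.mk_one, h1]
      linear_combination N 0 1 * hZ + Z 0 1 * hdet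
  exact ⟨N.col j, hj, key X hX, key Y hY⟩

theorem eigenvalue_root {g : SL(2, F)} {w : Fin 2 → F} {c : F} (hw : w ≠ 0)
    (h : g.1.mulVec w = c • w) : c ^ 2 - g.1.trace * c + 1 = 0 := by
  have hd := g.2
  have e0 := congrFun h 0
  have e1 := congrFun h 1
  simp only [Matrix.mulVec, dotProduct, Fin.sum_univ_two, Pi.smul_apply, smul_eq_mul] at e0 e1
  rw [Matrix.det_fin_two] at hd
  rw [Matrix.trace_fin_two]
  have k0 : (c ^ 2 - (g.1 0 0 + g.1 1 1) * c + 1) * w 0 = 0 := by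
    linear_combination (g.1 1 1 - c) * e0 - g.1 0 1 * e1 - w 0 * hd
  have k1 : (c ^ 2 - (g.1 0 0 + g.1 1 1) * c + 1) * w 1 = 0 := by
    linear_combination (g.1 0 0 - c) * e1 - g.1 1 0 * e0 - w 1 * hd
  by_contra hc
  apply hw
  ext i
  fin_cases i
  · simpa [hc] using k0
  · simpa [hc] using k1

theorem card_roots_le_two [DecidableEq F] [Fintype F] (t : F) :
    (Finset.univ.filter fun c : F ↦ c ^ 2 - t * c + 1 = 0).card ≤ 2 := by
  rcases (Finset.univ.filter fun c : F ↦ c ^ 2 - t * c + 1 = 0).eq_empty_or_nonempty with h | ⟨r, hr⟩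
  · simp [h]
  · refine (Finset.card_le_card (t := {r, t - r}) fun c hc ↦ ?_).trans Finset.card_le_two
    simp only [Finset.mem_filter, Finset.mem_univ, true_and, Finset.mem_insert,
      Finset.mem_singleton] at *
    have : (c - r) * (c - (t - r)) = 0 := by linear_combination hc - hr
    rcases mul_eq_zero.1 this with h | h
    · exact Or.inl (sub_eq_zero.1 h)
    · exact Or.inr (sub_eq_zero.1 h)

theorem mulVec_mul_inv_eq {s s' : SL(2, F)} {w : Fin 2 → F} {μ : F} (hw : w ≠ 0)
    (h : s.1.mulVec w = μ • w) (h' : s'.1.mulVec w = μ • w) :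
    (s * s'⁻¹).1.mulVec w = w := by
  have hμ : μ ≠ 0 := by
    rintro rfl
    have := eigenvalue_root hw h
    simp at this
  have h1 : (s'⁻¹).1.mulVec w = μ⁻¹ • w := by
    have : w = (s'⁻¹).1.mulVec (s'.1.mulVec w) := by
      rw [Matrix.mulVec_mulVec, ← Matrix.SpecialLinearGroup.coe_mul]
      simp
    rw [h', Matrix.mulVec_smul] at this
    conv_rhs => rw [this]
    rw [smul_smul, inv_mul_cancel₀ hμ, one_smul]
  rw [Matrix.SpecialLinearGroup.coe_mul, ← Matrix.mulVec_mulVec, h1, Matrix.mulVec_smul, h,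
    smul_smul, inv_mul_cancel₀ hμ, one_smul]

end Eigenvectors

/-! ### Counting degenerate pairs in a trace fibre. -/

section DegeneratePairs

variable {F : Type*} [Field F] [Fintype F] [DecidableEq F]

-- A non-scalar `s₀` has a single eigenline for `a`. Two elements acting on it by the same `b`
-- differ by an element fixing that line pointwise.
open Classical in
theorem card_common_eigenvector_le {S : Finset SL(2, F)} {M : ℕ}
    (hM : ∀ w : Fin 2 → F, w ≠ 0 → ((S * S⁻¹).filter fun x ↦ x.1.mulVec w = w).card ≤ M)
    {s₀ : SL(2, F)} (h₀ : s₀.1.trace ^ 2 ≠ 4) (a b : F) :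
    (S.filter fun s ↦ ∃ w : Fin 2 → F, w ≠ 0 ∧ s₀.1.mulVec w = a • w ∧
      s.1.mulVec w = b • w).card ≤ M := by
  rcases (S.filter fun s ↦ ∃ w : Fin 2 → F, w ≠ 0 ∧ s₀.1.mulVec w = a • w ∧
      s.1.mulVec w = b • w).eq_empty_or_nonempty with h | ⟨s', hs'⟩
  · rw [h]; exact Nat.zero_le _
  obtain ⟨hsS₁, w', hw', h₀w', hsw₁⟩ := Finset.mem_filter.1 hs'
  refine le_trans ?_ (hM w' hw')
  refine Finset.card_le_card_of_injOn (fun s ↦ s * s'⁻¹) ?_ fun x _ y _ h ↦ mul_right_cancel h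
  intro s hs
  obtain ⟨hsS, w, hw, h₀w, hsw⟩ := Finset.mem_filter.1 hs
  refine Finset.mem_filter.2 ⟨Finset.mul_mem_mul hsS (Finset.inv_mem_inv hsS₁), ?_⟩
  refine mulVec_mul_inv_eq hw' ?_ hsw₁
  have hcross : w 0 * w' 1 - w 1 * w' 0 = 0 := by
    by_contra hc
    refine ne_smul_one_of_trace_sq_ne_four h₀ a (eq_of_mulVec_eq hc ?_ ?_)
    · rw [h₀w, Matrix.smul_mulVec, Matrix.one_mulVec]
    · rw [h₀w', Matrix.smul_mulVec, Matrix.one_mulVec]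
  obtain ⟨c, rfl⟩ := eq_smul_of_cross_eq_zero hw hcross
  rw [Matrix.mulVec_smul, hsw, smul_comm]

/-- The `2` counts `s₀` and `s₀⁻¹`, the only elements of the fibre commuting with `s₀`; the `4`
counts pairs of eigenvalues, each a root of `c ^ 2 - t * c + 1`. -/
theorem card_degenerate_le (h2 : (2 : F) ≠ 0) {S : Finset SL(2, F)} {t : F} {M : ℕ}
    (ht : t ^ 2 ≠ 4) (hS : ∀ s ∈ S, s.1.trace = t)
    (hM : ∀ w : Fin 2 → F, w ≠ 0 → ((S * S⁻¹).filter fun x ↦ x.1.mulVec w = w).card ≤ M)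
    {s₀ : SL(2, F)} (h₀ : s₀ ∈ S) :
    (S.filter fun s₁ ↦ (s₀.1 * s₁.1 - s₁.1 * s₀.1).det = 0).card ≤ 2 + 4 * M := by
  classical
  set R := Finset.univ.filter fun c : F ↦ c ^ 2 - t * c + 1 = 0 with hR
  have ht₀ : s₀.1.trace ^ 2 ≠ 4 := by rwa [hS _ h₀]
  have hsub : (S.filter fun s₁ ↦ (s₀.1 * s₁.1 - s₁.1 * s₀.1).det = 0) ⊆
      {s₀, s₀⁻¹} ∪ (R ×ˢ R).biUnion fun ab ↦ S.filter fun s ↦ ∃ w : Fin 2 → F, w ≠ 0 ∧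
        s₀.1.mulVec w = ab.1 • w ∧ s.1.mulVec w = ab.2 • w := by
    intro s hs
    obtain ⟨hsS, hdet⟩ := Finset.mem_filter.1 hs
    by_cases hc : s₀.1 * s.1 - s.1 * s₀.1 = 0
    · have hcomm : s₀ * s = s * s₀ := Subtype.ext (sub_eq_zero.1 hc)
      have := eq_or_eq_inv_of_commute h2 ht₀ hcomm rfl ((hS _ hsS).trans (hS _ h₀).symm)
      exact Finset.mem_union_left _ (by simpa using this)
    · obtain ⟨w, hw, ⟨a, ha⟩, b, hb⟩ := exists_common_eigenvector hdet hc
      refine Finset.mem_union_right _ (Finset.mem_biUnion.2 ⟨(a, b), ?_, ?_⟩)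
      · have h1 := eigenvalue_root hw ha
        have h2 := eigenvalue_root hw hb
        rw [hS _ h₀] at h1
        rw [hS _ hsS] at h2
        simp [hR, h1, h2]
      · exact Finset.mem_filter.2 ⟨hsS, w, hw, ha, hb⟩
  refine (Finset.card_le_card hsub).trans ((Finset.card_union_le _ _).trans
    (Nat.add_le_add Finset.card_le_two ?_))
  refine (Finset.card_biUnion_le_card_mul _ _ M fun ab _ ↦
    card_common_eigenvector_le hM ht₀ ab.1 ab.2).trans (Nat.mul_le_mul_right _ ?_)
  rw [Finset.card_product]
  exact Nat.mul_le_mul (card_roots_le_two t) (card_roots_le_two t)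

end DegeneratePairs

/-! ### Elements fixing a vector. -/

section UnipotentBound

variable {F : Type*} [Field F]

/-- Otherwise the whole group would preserve the line of `w`, but the two elementary unipotent
matrices have no common eigenline. -/
theorem exists_not_eigenvector {B : Set SL(2, F)} (hgen : Subgroup.closure B = ⊤)
    {w : Fin 2 → F} (hw : w ≠ 0) :
    ∃ g ∈ B, w 0 * (g.1.mulVec w) 1 - w 1 * (g.1.mulVec w) 0 ≠ 0 := by
  by_contra! h
  have key : ∀ g : SL(2, F), ∃ c : F, g.1.mulVec w = c • w := by
    intro g
    have hg : g ∈ Subgroup.closure B := by rw [hgen]; trivial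
    induction hg using Subgroup.closure_induction with
    | mem x hx => exact eq_smul_of_cross_eq_zero hw (h x hx)
    | one => exact ⟨1, by simp [-Matrix.mulVec_fin_two]⟩
    | mul x y _ _ hx hy =>
      obtain ⟨a, ha⟩ := hx
      obtain ⟨b, hb⟩ := hy
      refine ⟨b * a, ?_⟩
      rw [Matrix.SpecialLinearGroup.coe_mul, ← Matrix.mulVec_mulVec, hb, Matrix.mulVec_smul, ha,
        smul_smul]
    | inv x _ hx =>
      obtain ⟨a, ha⟩ := hx
      refine ⟨x.1.trace - a, ?_⟩
      rw [Matrix.SpecialLinearGroup.inv_eq_trace_sub, Matrix.sub_mulVec, ha, Matrix.smul_mulVec,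
        Matrix.one_mulVec, sub_smul]
  obtain ⟨c, hc⟩ := key ⟨!![1, 1; 0, 1], by simp⟩
  obtain ⟨d, hd⟩ := key ⟨!![1, 0; 1, 1], by simp⟩
  have c0 := congrFun hc 0
  have c1 := congrFun hc 1
  have d0 := congrFun hd 0
  have d1 := congrFun hd 1
  simp only [Matrix.mulVec, dotProduct, Fin.sum_univ_two, Matrix.of_apply, Matrix.cons_val_zero,
    Matrix.cons_val_one, Matrix.cons_val_fin_one, Pi.smul_apply, smul_eq_mul, one_mul, zero_mul,
    zero_add, add_zero] at c0 c1 d0 d1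
  clear hc hd key h
  apply hw
  have e1 : w 1 = 0 := by
    by_contra h1
    have : c = 1 := mul_right_cancel₀ h1 (by linear_combination -c1)
    exact h1 (by rw [this] at c0; linear_combination c0)
  have e0 : w 0 = 0 := by rw [e1] at d1; linear_combination d1
  ext i
  fin_cases i
  · exact e0
  · exact e1

/-- Take a generator `g` moving the line of `w`. The map `(x, y) ↦ x * (g * y * g⁻¹)` is injective
on the stabilizer of `w`, since an element fixing both `w` and `g w` is trivial. -/
theorem card_fixing_sq_le [DecidableEq F] {B : Finset SL(2, F)} (hinv : B⁻¹ = B)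
    (hgen : Subgroup.closure (B : Set SL(2, F)) = ⊤) {w : Fin 2 → F} (hw : w ≠ 0) (k : ℕ) :
    ((B ^ k).filter fun x ↦ x.1.mulVec w = w).card ^ 2 ≤ (B ^ (2 * k + 2)).card := by
  obtain ⟨g, hgB, hg⟩ := exists_not_eigenvector hgen hw
  rw [sq, ← Finset.card_product]
  refine Finset.card_le_card_of_injOn (fun x ↦ x.1 * (g * x.2 * g⁻¹)) ?_ ?_
  · rintro ⟨x, y⟩ h
    simp only [Finset.coe_product, Set.mem_prod, Finset.mem_coe, Finset.mem_filter] at h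
    have e : B ^ (2 * k + 2) = B ^ k * (B * B ^ k * B) := by
      rw [← pow_succ', ← pow_succ, ← pow_add]; congr 1; ring
    simp only [e, Finset.mem_coe]
    refine Finset.mul_mem_mul h.1.1 (Finset.mul_mem_mul (Finset.mul_mem_mul hgB h.2.1) ?_)
    rw [← hinv]
    exact Finset.inv_mem_inv hgB
  · rintro ⟨x, y⟩ h ⟨x', y'⟩ h' heq
    simp only [Finset.coe_product, Set.mem_prod, Finset.mem_coe, Finset.mem_filter] at h h'
    simp only at heq
    have fixinv : ∀ x : SL(2, F), x.1.mulVec w = w → (x⁻¹).1.mulVec w = w := by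
      intro x hx
      conv_lhs => rw [← hx]
      rw [Matrix.mulVec_mulVec, ← Matrix.SpecialLinearGroup.coe_mul]
      simp [-Matrix.mulVec_fin_two]
    have hz : x'⁻¹ * x = g * (y' * y⁻¹) * g⁻¹ := by
      have : x = x' * (g * y' * g⁻¹) * (g * y * g⁻¹)⁻¹ := by rw [← heq]; group
      rw [this]; group
    have h1 : (x'⁻¹ * x).1 = (1 : SL(2, F)).1 := by
      refine eq_of_mulVec_eq hg ?_ ?_
      · rw [Matrix.SpecialLinearGroup.coe_mul, ← Matrix.mulVec_mulVec, h.1.2, fixinv _ h'.1.2]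
        simp [-Matrix.mulVec_fin_two]
      · rw [hz, Matrix.mulVec_mulVec, ← Matrix.SpecialLinearGroup.coe_mul, inv_mul_cancel_right,
          Matrix.SpecialLinearGroup.coe_mul, ← Matrix.mulVec_mulVec,
          Matrix.SpecialLinearGroup.coe_mul, ← Matrix.mulVec_mulVec, fixinv _ h.2.2, h'.2.2]
        simp [-Matrix.mulVec_fin_two]
    have h1' : x'⁻¹ * x = 1 := Subtype.ext h1
    have h2 : x = x' := (inv_mul_eq_one.1 h1').symm
    rw [h2] at heq
    rw [h2, Prod.mk.injEq]
    exact ⟨rfl, mul_left_cancel (mul_right_cancel (mul_left_cancel heq))⟩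

end UnipotentBound

/-! ### The upper bound for trace fibres. -/

section TraceFibreBound

variable {F : Type*} [Field F] [Fintype F] [DecidableEq F]

/-- A trace fibre, other than the degenerate ones, contains at most about `N ^ (2 / 3)` elements of
a power of a generating set. -/
theorem card_trace_fibre_le (h2 : (2 : F) ≠ 0) {B : Finset SL(2, F)} (h1 : 1 ∈ B) (hinv : B⁻¹ = B)
    (hgen : Subgroup.closure (B : Set SL(2, F)) = ⊤) {t : F} (ht : t ≠ 0) (ht4 : t ^ 2 ≠ 4) :
    ((B ^ 6).filter fun s ↦ s.1.trace = t).card ^ 3 ≤ 4096 * (B ^ 26).card ^ 2 := by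
  set S := (B ^ 6).filter fun s ↦ s.1.trace = t with hSdef
  have hS : ∀ s ∈ S, s.1.trace = t := fun s hs ↦ (Finset.mem_filter.1 hs).2
  have hSB : S ⊆ B ^ 6 := Finset.filter_subset _ _
  have hSinv : S⁻¹ ⊆ B ^ 6 := by
    have : (B ^ 6)⁻¹ = B ^ 6 := by rw [← inv_pow, hinv]
    rw [← this]
    exact Finset.inv_subset_inv hSB
  set N := (B ^ 26).card with hN
  have hpos : ∀ k : ℕ, 0 < (B ^ k).card := fun k ↦ Finset.card_pos.2 ⟨1, Finset.one_mem_pow h1⟩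
  have hNpos : 0 < N := hpos 26
  have hM : ∀ w : Fin 2 → F, w ≠ 0 →
      ((S * S⁻¹).filter fun x ↦ x.1.mulVec w = w).card ≤ Nat.sqrt N := by
    intro w hw
    rw [Nat.le_sqrt']
    -- `S * S⁻¹` lies in `B ^ 12`, and `26 = 2 * 12 + 2`: this is the source of the exponent `26`.
    have h12 := card_fixing_sq_le hinv hgen hw 12
    simp only [Nat.reduceMul, Nat.reduceAdd] at h12
    refine le_trans (Nat.pow_le_pow_left (Finset.card_le_card ?_) 2) h12
    refine Finset.filter_subset_filter _ ?_
    rw [show 12 = 6 + 6 from rfl, pow_add]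
    exact Finset.mul_subset_mul hSB hSinv
  have hmain := card_good_triples_le ht hS fun s₀ hs₀ ↦ card_degenerate_le h2 ht4 hS hM hs₀
  have hSS : (S * S).card ≤ N := by
    refine Finset.card_le_card ((Finset.mul_subset_mul hSB hSB).trans ?_)
    rw [← pow_add]
    exact Finset.pow_subset_pow_right h1 (by norm_num)
  have hsq : Nat.sqrt N ^ 2 ≤ N := Nat.sqrt_le' N
  have hsq1 : 1 ≤ Nat.sqrt N := by rw [Nat.le_sqrt']; simpa using Nat.succ_le_of_lt hNpos
  set r := Nat.sqrt N
  have hSS2 : (S * S).card ^ 2 ≤ N ^ 2 := Nat.pow_le_pow_left hSS 2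
  -- Above this threshold the degenerate terms cost at most half of each factor; below it the claim
  -- holds since `r ^ 4 ≤ N ^ 2` and `16 ^ 3 = 4096`.
  by_cases hbig : 16 * r ≤ S.card
  · have a1 : S.card ≤ 2 * (S.card - (2 + 4 * r)) := by omega
    have a2 : S.card ≤ 2 * (S.card - 2) := by omega
    calc S.card ^ 3 = S.card * (S.card * S.card) := by ring
      _ ≤ S.card * ((2 * (S.card - (2 + 4 * r))) * (2 * (S.card - 2))) := by gcongr
      _ = 4 * (S.card * ((S.card - (2 + 4 * r)) * (S.card - 2))) := by ring
      _ ≤ 4 * (2 * (S * S).card ^ 2) := by gcongr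
      _ ≤ 4 * (2 * N ^ 2) := by gcongr
      _ ≤ 4096 * N ^ 2 := by nlinarith [Nat.zero_le (N ^ 2)]
  · have : S.card ≤ 16 * r := by omega
    calc S.card ^ 3 ≤ (16 * r) ^ 3 := by gcongr
      _ = 4096 * (r ^ 3 * 1) := by ring
      _ ≤ 4096 * (r ^ 3 * r) := by gcongr
      _ = 4096 * (r ^ 2) ^ 2 := by ring
      _ ≤ 4096 * N ^ 2 := by gcongr

end TraceFibreBound

/-! ### Escape from the exceptional traces. -/

section Escape

variable {F : Type*} [Field F]

theorem span_specialLinearGroup_eq_top (V : Submodule F (Matrix (Fin 2) (Fin 2) F))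
    (h : ∀ g : SL(2, F), g.1 ∈ V) : V = ⊤ := by
  have h1 : (1 : Matrix (Fin 2) (Fin 2) F) ∈ V := h 1
  have h2 : !![1, 1; 0, 1] ∈ V := h ⟨!![1, 1; 0, 1], by simp⟩
  have h3 : !![1, 0; 1, 1] ∈ V := h ⟨!![1, 0; 1, 1], by simp⟩
  have h4 : !![2, 1; 1, 1] ∈ V := h ⟨!![2, 1; 1, 1], by simp [Matrix.det_fin_two]; norm_num⟩
  rw [eq_top_iff]
  intro M _
  have : M = (M 0 0 - M 0 1 - M 1 0) • (1 : Matrix (Fin 2) (Fin 2) F)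
      + (M 0 1 - (M 0 0 - M 1 1)) • !![1, 1; 0, 1] + (M 1 0 - (M 0 0 - M 1 1)) • !![1, 0; 1, 1]
      + (M 0 0 - M 1 1) • !![2, 1; 1, 1] := by
    ext i j
    fin_cases i <;> fin_cases j <;> simp <;> ring
  rw [this]
  exact V.add_mem (V.add_mem (V.add_mem (V.smul_mem _ h1) (V.smul_mem _ h2)) (V.smul_mem _ h3))
    (V.smul_mem _ h4)

/-- The spans of `B ^ k` start in dimension one and grow strictly until stable. A stable span is
invariant under the group and contains `1`, hence is everything; dimension four is reached by `k =
3`. -/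
theorem span_pow_three_eq_top [DecidableEq F] {B : Finset SL(2, F)} (h1 : 1 ∈ B) (hinv : B⁻¹ = B)
    (hgen : Subgroup.closure (B : Set SL(2, F)) = ⊤) :
    Submodule.span F ((fun g : SL(2, F) ↦ g.1) '' ((B ^ 3 : Finset SL(2, F)) : Set SL(2, F)) :
      Set (Matrix (Fin 2) (Fin 2) F)) = ⊤ := by
  let V : ℕ → Submodule F (Matrix (Fin 2) (Fin 2) F) := fun k ↦
    Submodule.span F ((fun g : SL(2, F) ↦ g.1) '' ((B ^ k : Finset SL(2, F)) : Set SL(2, F)))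
  have hone : ∀ k, (1 : Matrix (Fin 2) (Fin 2) F) ∈ V k := fun k ↦
    Submodule.subset_span ⟨1, Finset.one_mem_pow h1, rfl⟩
  have hmono : ∀ k, V k ≤ V (k + 1) := fun k ↦ Submodule.span_mono
    (Set.image_mono (Finset.coe_subset.2 (Finset.pow_subset_pow_right h1 (Nat.le_succ k))))
  have hmul : ∀ k, ∀ b ∈ B, ∀ M ∈ V k, b.1 * M ∈ V (k + 1) := by
    intro k b hb M hM
    induction hM using Submodule.span_induction with
    | mem x hx =>
      obtain ⟨y, hy, rfl⟩ := hx
      refine Submodule.subset_span ⟨b * y, ?_, rfl⟩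
      rw [pow_succ']
      exact Finset.mem_coe.2 (Finset.mul_mem_mul hb hy)
    | zero => simp
    | add x y _ _ hx hy => rw [mul_add]; exact add_mem hx hy
    | smul a x _ hx => rw [mul_smul_comm]; exact Submodule.smul_mem _ _ hx
  have hstab : ∀ k, V k = V (k + 1) → V k = ⊤ := by
    intro k hk
    have hall : ∀ g : SL(2, F), ∀ M ∈ V k, g.1 * M ∈ V k := by
      intro g
      have hg : g ∈ Subgroup.closure (B : Set SL(2, F)) := by rw [hgen]; trivial
      induction hg using Subgroup.closure_induction'' with
      | one => intro M hM; simpa using hM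
      | mem x hx => intro M hM; rw [hk]; exact hmul k x hx M hM
      | inv_mem x hx =>
        intro M hM
        rw [hk]
        refine hmul k _ ?_ M hM
        rw [← hinv]
        exact Finset.inv_mem_inv hx
      | mul x y _ _ hx hy =>
        intro M hM
        rw [Matrix.SpecialLinearGroup.coe_mul, mul_assoc]
        exact hx _ (hy _ hM)
    refine span_specialLinearGroup_eq_top _ fun g ↦ ?_
    simpa using hall g 1 (hone k)
  have hrank : ∀ k, V k = ⊤ ∨ k + 1 ≤ Module.finrank F (V k) := by
    intro k
    induction k with
    | zero =>
      right
      rw [zero_add, Nat.one_le_iff_ne_zero, ne_eq, Submodule.finrank_eq_zero]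
      intro h
      have := hone 0
      rw [h, Submodule.mem_bot] at this
      exact one_ne_zero this
    | succ k ih =>
      by_cases hk : V k = V (k + 1)
      · left
        rw [← hk]
        exact hstab k hk
      · have hlt := lt_of_le_of_ne (hmono k) hk
        have := Submodule.finrank_lt_finrank_of_lt hlt
        rcases ih with ih | ih
        · rw [ih] at hlt
          exact absurd hlt not_top_lt
        · right
          omega
  rcases hrank 3 with h | h
  · exact h
  · apply Submodule.eq_top_of_finrank_eq
    refine le_antisymm (Submodule.finrank_le _) ?_
    rw [Module.finrank_matrix]
    simpa using h

/-- A basis `f` of matrices taken from `B ^ 3` makes `v` determined by the four traces `tr (f i *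
v)`. If all traces on `B ^ 4` were in `{0, 2, -2}`, there would be at most `3 ^ 4 = 81` such `v`. -/
theorem exists_trace_ne [DecidableEq F] {B : Finset SL(2, F)} (h1 : 1 ∈ B)
    (hinv : B⁻¹ = B) (hgen : Subgroup.closure (B : Set SL(2, F)) = ⊤) (hB : 81 < B.card) :
    ∃ g ∈ B ^ 4, g.1.trace ≠ 0 ∧ g.1.trace ^ 2 ≠ 4 := by
  by_contra! hcon
  have htr : ∀ g ∈ B ^ 4, g.1.trace ∈ ({0, 2, -2} : Finset F) := by
    intro g hg
    by_cases h0 : g.1.trace = 0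
    · simp [h0]
    · have h4 := hcon g hg h0
      have : (g.1.trace - 2) * (g.1.trace + 2) = 0 := by linear_combination h4
      rcases mul_eq_zero.1 this with h | h
      · simp [sub_eq_zero.1 h]
      · simp [eq_neg_of_add_eq_zero_left h]
  obtain ⟨f, hf, hspan, -⟩ := Submodule.exists_fun_fin_finrank_span_eq F
    ((fun g : SL(2, F) ↦ g.1) '' ((B ^ 3 : Finset SL(2, F)) : Set SL(2, F)) : Set (Matrix (Fin 2) (Fin 2) F))
  replace hspan := hspan.trans (span_pow_three_eq_top h1 hinv hgen)
  have hinj : B.card ≤ (Fintype.piFinset fun _ : Fin (Module.finrank F (Submodule.span F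
      ((fun g : SL(2, F) ↦ g.1) '' ((B ^ 3 : Finset SL(2, F)) : Set SL(2, F))))) ↦
        ({0, 2, -2} : Finset F)).card := by
    refine Finset.card_le_card_of_injOn (fun v i ↦ (f i * v.1).trace) ?_ ?_
    · intro v hv
      simp only [Finset.mem_coe, Fintype.mem_piFinset]
      intro i
      obtain ⟨x, hx, hxi⟩ := hf i
      rw [← hxi]
      refine htr (x * v) ?_
      rw [pow_succ]
      exact Finset.mul_mem_mul hx hv
    · intro v _ v' _ h
      have hall : ∀ M : Matrix (Fin 2) (Fin 2) F, (M * v.1).trace = (M * v'.1).trace := by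
        intro M
        have hM : M ∈ Submodule.span F (Set.range f) := by rw [hspan]; trivial
        induction hM using Submodule.span_induction with
        | mem x hx => obtain ⟨i, rfl⟩ := hx; exact congrFun h i
        | zero => simp
        | add x y _ _ hx hy => rw [add_mul, add_mul, Matrix.trace_add, Matrix.trace_add, hx, hy]
        | smul a x _ hx =>
          rw [smul_mul_assoc, smul_mul_assoc, Matrix.trace_smul, Matrix.trace_smul, hx]
      apply Subtype.ext
      ext i j
      simpa [Matrix.trace_single_mul] using hall (Matrix.single j i 1)
  rw [Fintype.card_piFinset_const, span_pow_three_eq_top h1 hinv hgen, finrank_top, Module.finrank_matrix] at hinj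
  have h3 : ({0, 2, -2} : Finset F).card ≤ 3 := Finset.card_le_three
  have := Nat.pow_le_pow_left h3 4
  simp at hinj
  omega

end Escape

/-! ### Pivoting over conjugates of a torus. -/

section Pivot

variable {F : Type*} [Field F]

theorem mul_comm_of_commute {g h k : SL(2, F)} (hg : ∀ c : F, g.1 ≠ c • 1)
    (hh : g * h = h * g) (hk : g * k = k * g) : h * k = k * h := by
  obtain ⟨α, β, hh'⟩ := exists_eq_add_smul_of_commute hg (congrArg Subtype.val hh)
  obtain ⟨γ, δ, hk'⟩ := exists_eq_add_smul_of_commute hg (congrArg Subtype.val hk)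
  apply Subtype.ext
  change h.1 * k.1 = k.1 * h.1
  rw [hh', hk']
  simp only [add_mul, mul_add, smul_mul_assoc, mul_smul_comm, one_mul, mul_one]
  module

theorem card_le_two_of_commute_of_trace [DecidableEq F] (h2 : (2 : F) ≠ 0) {g : SL(2, F)}
    (hg : g.1.trace ^ 2 ≠ 4) {D : Finset SL(2, F)} {τ : F}
    (hD : ∀ x ∈ D, g * x = x * g ∧ x.1.trace = τ) : D.card ≤ 2 := by
  rcases D.eq_empty_or_nonempty with rfl | ⟨k, hk⟩
  · simp
  refine (Finset.card_le_card (t := {k, k⁻¹}) fun x hx ↦ ?_).trans Finset.card_le_two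
  have := eq_or_eq_inv_of_commute h2 hg (hD x hx).1 (hD k hk).1
    ((hD x hx).2.trans (hD k hk).2.symm)
  simpa using this

/-- Each of the three bad traces occurs at most twice in the centralizer, so more than six elements
suffice. -/
theorem exists_trace_ne_of_card [DecidableEq F] (h2 : (2 : F) ≠ 0) {g : SL(2, F)}
    (hg : g.1.trace ^ 2 ≠ 4) {D : Finset SL(2, F)} (hD : ∀ x ∈ D, g * x = x * g)
    (hcard : 8 < D.card) : ∃ x ∈ D, x.1.trace ≠ 0 ∧ x.1.trace ^ 2 ≠ 4 := by
  by_contra! hcon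
  have hmaps : ∀ x ∈ D, x.1.trace ∈ ({0, 2, -2} : Finset F) := by
    intro x hx
    by_cases h0 : x.1.trace = 0
    · simp [h0]
    · have h4 := hcon x hx h0
      have : (x.1.trace - 2) * (x.1.trace + 2) = 0 := by linear_combination h4
      rcases mul_eq_zero.1 this with h | h
      · simp [sub_eq_zero.1 h]
      · simp [eq_neg_of_add_eq_zero_left h]
  have h6 := Finset.card_le_mul_card_image_of_maps_to hmaps 2 fun τ _ ↦
    card_le_two_of_commute_of_trace h2 hg (τ := τ) fun x hx ↦
      ⟨hD x (Finset.mem_filter.1 hx).1, (Finset.mem_filter.1 hx).2⟩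
  have h3 : ({0, 2, -2} : Finset F).card ≤ 3 := Finset.card_le_three
  omega

/-- Orbit–stabilizer for sets: conjugation of `g` by `B` lands in a trace fibre of `B ^ 6`, and two
conjugators with the same image differ by a centralizing element of `B ^ 2`. -/
theorem card_le_card_fibre_mul_card_centralizer [DecidableEq F] {B : Finset SL(2, F)}
    (hinv : B⁻¹ = B) {g : SL(2, F)} (hg : g ∈ B ^ 4) :
    B.card ≤ ((B ^ 2).filter fun x ↦ g * x = x * g).card *
      ((B ^ 6).filter fun s ↦ s.1.trace = g.1.trace).card := by
  have hinv' : ∀ b ∈ B, b⁻¹ ∈ B := fun b hb ↦ by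
    rw [← hinv]; exact Finset.inv_mem_inv hb
  refine Finset.card_le_mul_card_image_of_maps_to (f := fun b ↦ b * g * b⁻¹) ?_ _ ?_
  · intro b hb
    refine Finset.mem_filter.2 ⟨?_, Matrix.SpecialLinearGroup.trace_conj g b⟩
    rw [pow_succ, pow_succ']
    exact Finset.mul_mem_mul (Finset.mul_mem_mul hb hg) (hinv' b hb)
  · intro y _
    rcases (B.filter fun b ↦ b * g * b⁻¹ = y).eq_empty_or_nonempty with h | ⟨b₀, hb₀⟩
    · simp [h]
    obtain ⟨hb₀, e₀⟩ := Finset.mem_filter.1 hb₀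
    refine Finset.card_le_card_of_injOn (fun b ↦ b₀⁻¹ * b) ?_ fun x _ y _ h ↦ mul_left_cancel h
    intro b hb
    obtain ⟨hb, e⟩ := Finset.mem_filter.1 hb
    refine Finset.mem_coe.2 (Finset.mem_filter.2 ⟨?_, ?_⟩)
    · rw [sq]
      exact Finset.mul_mem_mul (hinv' _ hb₀) hb
    · have h1 : b * g = b₀ * g * b₀⁻¹ * b := by rw [e₀, ← e]; group
      have h2 : b₀⁻¹ * b * g = g * (b₀⁻¹ * b) := by rw [mul_assoc, h1]; group
      exact h2.symm

/-- If every admissible element of `B ^ 4` has a rich centralizer, then so does every conjugate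
of an admissible element. -/
theorem le_card_centralizer_conj [DecidableEq F] (h2 : (2 : F) ≠ 0)
    {B : Finset SL(2, F)} (h1 : 1 ∈ B) (hinv : B⁻¹ = B)
    (hgen : Subgroup.closure (B : Set SL(2, F)) = ⊤) {n : ℕ} (hn8 : 8 < n)
    (hn : ∀ g ∈ B ^ 4, g.1.trace ≠ 0 → g.1.trace ^ 2 ≠ 4 →
      n ≤ ((B ^ 2).filter fun x ↦ g * x = x * g).card)
    {g₀ : SL(2, F)} (hg₀ : g₀ ∈ B ^ 4) (ht0 : g₀.1.trace ≠ 0) (ht4 : g₀.1.trace ^ 2 ≠ 4)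
    (x : SL(2, F)) :
    n ≤ ((B ^ 2).filter fun y ↦ x * g₀ * x⁻¹ * y = y * (x * g₀ * x⁻¹)).card := by
  have hinv' : ∀ b ∈ B, b⁻¹ ∈ B := fun b hb ↦ by
    rw [← hinv]; exact Finset.inv_mem_inv hb
  have hex : ∀ g ∈ B ^ 4, g.1.trace ≠ 0 → g.1.trace ^ 2 ≠ 4 →
      ∃ y ∈ B ^ 2, g * y = y * g ∧ y.1.trace ≠ 0 ∧ y.1.trace ^ 2 ≠ 4 := by
    intro g hg h0 h4
    obtain ⟨y, hy, h⟩ := exists_trace_ne_of_card h2 h4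
      (fun x hx ↦ (Finset.mem_filter.1 hx).2) (hn8.trans_le (hn g hg h0 h4))
    exact ⟨y, (Finset.mem_filter.1 hy).1, (Finset.mem_filter.1 hy).2, h⟩
  -- The word length of `z` does not accumulate: the witness `y` in `B ^ 2` is conjugated into `B ^
  -- 4`, whose rich centralizer supplies a new witness in `B ^ 2`. Commutativity of the centralizer
  -- links it to the new conjugate of `g₀`.
  have hstep : ∀ b ∈ B, ∀ z : SL(2, F),
      (∃ y ∈ B ^ 2, z * g₀ * z⁻¹ * y = y * (z * g₀ * z⁻¹) ∧ y.1.trace ≠ 0 ∧ y.1.trace ^ 2 ≠ 4) →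
      ∃ y ∈ B ^ 2, b * z * g₀ * (b * z)⁻¹ * y = y * (b * z * g₀ * (b * z)⁻¹) ∧
        y.1.trace ≠ 0 ∧ y.1.trace ^ 2 ≠ 4 := by
    rintro b hb z ⟨y, hy, hc, h0, h4⟩
    have hmem : b * y * b⁻¹ ∈ B ^ 4 := by
      rw [show B ^ 4 = B * B ^ 2 * B by rw [← pow_succ', ← pow_succ]]
      exact Finset.mul_mem_mul (Finset.mul_mem_mul hb hy) (hinv' b hb)
    have htr := Matrix.SpecialLinearGroup.trace_conj y b
    obtain ⟨y', hy', hc', h'⟩ := hex _ hmem (by rwa [htr]) (by rwa [htr])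
    refine ⟨y', hy', mul_comm_of_commute (g := b * y * b⁻¹)
      (ne_smul_one_of_trace_sq_ne_four (by rwa [htr])) ?_ hc', h'⟩
    calc b * y * b⁻¹ * (b * z * g₀ * (b * z)⁻¹) = b * (y * (z * g₀ * z⁻¹)) * b⁻¹ := by group
      _ = b * (z * g₀ * z⁻¹ * y) * b⁻¹ := by rw [hc]
      _ = b * z * g₀ * (b * z)⁻¹ * (b * y * b⁻¹) := by group
  have hall : ∃ y ∈ B ^ 2, x * g₀ * x⁻¹ * y = y * (x * g₀ * x⁻¹) ∧ y.1.trace ≠ 0 ∧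
      y.1.trace ^ 2 ≠ 4 := by
    have hx : x ∈ Subgroup.closure (B : Set SL(2, F)) := by rw [hgen]; trivial
    induction hx using Subgroup.closure_induction_left with
    | one => simpa using hex g₀ hg₀ ht0 ht4
    | mul_left b hb z _ ih => exact hstep b hb z ih
    | inv_mul_cancel b hb z _ ih => exact hstep b⁻¹ (hinv' b hb) z ih
  obtain ⟨y, hy, hc, h0, h4⟩ := hall
  refine (hn y (Finset.pow_subset_pow_right h1 (by norm_num) hy) h0 h4).trans
    (Finset.card_le_card fun k hk ↦ ?_)
  obtain ⟨hk, hk'⟩ := Finset.mem_filter.1 hk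
  exact Finset.mem_filter.2 ⟨hk, mul_comm_of_commute (ne_smul_one_of_trace_sq_ne_four h4) hc.symm hk'⟩

variable [Fintype F] [DecidableEq F]

theorem card_centralizer_le {y : SL(2, F)} (hy : ∀ c : F, y.1 ≠ c • 1) :
    (Finset.univ.filter fun z : SL(2, F) ↦ y * z = z * y).card ≤ 2 * Fintype.card F := by
  let P : Finset (F × F) := Finset.univ.filter fun ab ↦
    ab.1 ^ 2 + ab.1 * ab.2 * y.1.trace + ab.2 ^ 2 = 1
  have hP : P.card ≤ 2 * Fintype.card F := by
    refine Finset.card_le_mul_card_image_of_maps_to (f := Prod.snd) (t := Finset.univ)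
      (fun _ _ ↦ Finset.mem_univ _) 2 fun b _ ↦ ?_
    rcases (P.filter fun ab ↦ ab.2 = b).eq_empty_or_nonempty with h | ⟨⟨r, b'⟩, hr⟩
    · simp [h]
    simp only [P, Finset.mem_filter, Finset.mem_univ, true_and] at hr
    obtain ⟨hr, rfl⟩ := hr
    refine (Finset.card_le_card (t := {(r, b'), (-b' * y.1.trace - r, b')}) ?_).trans
      Finset.card_le_two
    rintro ⟨a, b⟩ hab
    simp only [P, Finset.mem_filter, Finset.mem_univ, true_and] at hab
    obtain ⟨hab, rfl⟩ := hab
    have : (a - r) * (a - (-b * y.1.trace - r)) = 0 := by linear_combination hab - hr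
    rcases mul_eq_zero.1 this with h | h
    · simp [sub_eq_zero.1 h]
    · simp [sub_eq_zero.1 h]
  refine le_trans ?_ hP
  have hsub : ((Finset.univ.filter fun z : SL(2, F) ↦ y * z = z * y).image fun z ↦ z.1) ⊆
      P.image fun ab ↦ ab.1 • (1 : Matrix (Fin 2) (Fin 2) F) + ab.2 • y.1 := by
    intro M hM
    obtain ⟨z, hz, rfl⟩ := Finset.mem_image.1 hM
    obtain ⟨α, β, h⟩ := exists_eq_add_smul_of_commute hy
      (congrArg Subtype.val (Finset.mem_filter.1 hz).2)
    refine Finset.mem_image.2 ⟨(α, β), ?_, h.symm⟩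
    have hd := z.2
    rw [h, det_one_add_smul, y.2, mul_one] at hd
    simp [P, hd]
  have := (Finset.card_le_card hsub).trans Finset.card_image_le
  have hinj : Function.Injective fun z : SL(2, F) ↦ z.1 := fun a b h ↦ Subtype.ext h
  rwa [Finset.card_image_of_injective _ hinj] at this

/-- The element `x⁻¹ * y * x` centralizes `g` and has the trace of `y`, so it takes at most two
values; each fibre lies in a coset of the centralizer of `y`. -/
theorem card_conjugators_le (h2 : (2 : F) ≠ 0) {g y : SL(2, F)} (hg : g.1.trace ^ 2 ≠ 4)
    (hy : ∀ c : F, y.1 ≠ c • 1) :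
    (Finset.univ.filter fun x : SL(2, F) ↦ x * g * x⁻¹ * y = y * (x * g * x⁻¹)).card
      ≤ 4 * Fintype.card F := by
  set X := Finset.univ.filter fun x : SL(2, F) ↦ x * g * x⁻¹ * y = y * (x * g * x⁻¹) with hX
  have himg : (X.image fun x ↦ x⁻¹ * y * x).card ≤ 2 := by
    refine card_le_two_of_commute_of_trace h2 hg (τ := y.1.trace) fun k hk ↦ ?_
    obtain ⟨x, hx, rfl⟩ := Finset.mem_image.1 hk
    have hx := (Finset.mem_filter.1 hx).2
    constructor
    · calc g * (x⁻¹ * y * x) = x⁻¹ * (x * g * x⁻¹ * y) * x := by group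
        _ = x⁻¹ * (y * (x * g * x⁻¹)) * x := by rw [hx]
        _ = x⁻¹ * y * x * g := by group
    · simpa using Matrix.SpecialLinearGroup.trace_conj y x⁻¹
  have := Finset.card_le_mul_card_image (f := fun x ↦ x⁻¹ * y * x) X (2 * Fintype.card F) ?_
  · calc X.card ≤ 2 * Fintype.card F * (X.image fun x ↦ x⁻¹ * y * x).card := this
      _ ≤ 2 * Fintype.card F * 2 := by gcongr
      _ = 4 * Fintype.card F := by ring
  · intro k hk
    obtain ⟨x₀, -, e₀⟩ := Finset.mem_image.1 hk
    refine le_trans ?_ (card_centralizer_le hy)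
    refine Finset.card_le_card_of_injOn (fun x ↦ x * x₀⁻¹) ?_ fun x _ y _ h ↦ mul_right_cancel h
    intro x hx
    have e := (Finset.mem_filter.1 hx).2
    refine Finset.mem_coe.2 (Finset.mem_filter.2 ⟨Finset.mem_univ _, ?_⟩)
    calc y * (x * x₀⁻¹) = x * (x⁻¹ * y * x) * x₀⁻¹ := by group
      _ = x * (x₀⁻¹ * y * x₀) * x₀⁻¹ := by rw [e, e₀]
      _ = x * x₀⁻¹ * y := by group

theorem le_card_specialLinearGroup :
    (Fintype.card F - 1) * Fintype.card F ^ 2 ≤ Fintype.card SL(2, F) := by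
  have h := Fintype.card_le_of_injective (α := Fˣ × F × F) (β := SL(2, F))
    (fun x ↦ ⟨!![(x.1 : F), x.2.1; x.2.2, (1 + x.2.1 * x.2.2) * (x.1 : F)⁻¹], by
      rw [Matrix.det_fin_two_of]
      field_simp
      ring⟩) (by
      rintro ⟨a, b, c⟩ ⟨a', b', c'⟩ h
      have h := congrArg Subtype.val h
      have h00 := congrFun₂ h 0 0
      have h01 := congrFun₂ h 0 1
      have h10 := congrFun₂ h 1 0
      simp at h00 h01 h10
      rw [Units.ext h00, h01, h10])
  rw [Fintype.card_prod, Fintype.card_prod, Fintype.card_units] at h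
  rwa [sq]

/-- A symmetric generating set either has few elements, or grows, or fills the group. -/
theorem growth_trichotomy (h2 : (2 : F) ≠ 0) {B : Finset SL(2, F)} (h1 : 1 ∈ B) (hinv : B⁻¹ = B)
    (hgen : Subgroup.closure (B : Set SL(2, F)) = ⊤) :
    B.card ≤ 81 ∨ B.card ^ 3 ≤ 2 ^ 21 * (B ^ 26).card ^ 2 ∨
      Fintype.card F ^ 6 * B.card ^ 3 ≤ 2 ^ 24 * (B ^ 26).card ^ 5 := by
  by_cases hB : B.card ≤ 81
  · exact Or.inl hB
  right
  have hlow : ∀ g ∈ B ^ 4, g.1.trace ≠ 0 → g.1.trace ^ 2 ≠ 4 → B.card ^ 3 ≤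
      ((B ^ 2).filter fun x ↦ g * x = x * g).card ^ 3 * (4096 * (B ^ 26).card ^ 2) := by
    intro g hg h0 h4
    have := Nat.pow_le_pow_left (card_le_card_fibre_mul_card_centralizer hinv hg) 3
    rw [mul_pow] at this
    exact this.trans (Nat.mul_le_mul_left _ (card_trace_fibre_le h2 h1 hinv hgen h0 h4))
  obtain ⟨g₁, hg₁, h₁0, h₁4⟩ := exists_trace_ne h1 hinv hgen (not_le.1 hB)
  -- Choosing `g` with the smallest centralizer makes `n` a lower bound for all admissible elements,
  -- as the pivot argument requires.
  obtain ⟨g, hg, hmin⟩ := Finset.exists_min_image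
    ((B ^ 4).filter fun g ↦ g.1.trace ≠ 0 ∧ g.1.trace ^ 2 ≠ 4)
    (fun g ↦ ((B ^ 2).filter fun x ↦ g * x = x * g).card)
    ⟨g₁, Finset.mem_filter.2 ⟨hg₁, h₁0, h₁4⟩⟩
  obtain ⟨hg, h0, h4⟩ := Finset.mem_filter.1 hg
  have hg3 := hlow g hg h0 h4
  set n := ((B ^ 2).filter fun x ↦ g * x = x * g).card with hn
  by_cases hn8 : n ≤ 8
  · left
    calc B.card ^ 3 ≤ n ^ 3 * (4096 * (B ^ 26).card ^ 2) := hg3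
      _ ≤ 8 ^ 3 * (4096 * (B ^ 26).card ^ 2) := by gcongr
      _ = 2 ^ 21 * (B ^ 26).card ^ 2 := by ring
  right
  have hn8 : 8 < n := not_le.1 hn8
  -- Double count the pairs `(x, y)` with `y` in `B ^ 2` centralizing `x * g * x⁻¹`. The scalars `1`
  -- and `-1` are discarded because they commute with everything.
  have hcount : Fintype.card SL(2, F) * (n - 2) ≤ (B ^ 2).card * (4 * Fintype.card F) := by
    have hdc := Finset.card_mul_le_card_mul (s := (Finset.univ : Finset SL(2, F)))
      (t := (B ^ 2).filter fun y ↦ y ≠ 1 ∧ y ≠ -1) (m := n - 2) (n := 4 * Fintype.card F)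
      (fun x y : SL(2, F) ↦ x * g * x⁻¹ * y = y * (x * g * x⁻¹)) ?_ ?_
    · rw [Finset.card_univ] at hdc
      exact hdc.trans (Nat.mul_le_mul_right _ (Finset.card_filter_le _ _))
    · intro x _
      have hx := le_card_centralizer_conj h2 h1 hinv hgen hn8 (fun k hk hk0 hk4 ↦
        hmin k (Finset.mem_filter.2 ⟨hk, hk0, hk4⟩)) hg h0 h4 x
      refine le_trans ?_ (Finset.card_le_card (s := ((B ^ 2).filter fun y ↦
        x * g * x⁻¹ * y = y * (x * g * x⁻¹)) \ {1, -1}) ?_)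
      · exact (tsub_le_tsub hx Finset.card_le_two).trans (Finset.le_card_sdiff _ _)
      · intro y hy
        simp only [Finset.mem_sdiff, Finset.mem_filter, Finset.mem_insert, Finset.mem_singleton,
          not_or] at hy
        simp only [Finset.mem_bipartiteAbove, Finset.mem_filter]
        exact ⟨⟨hy.1.1, hy.2⟩, hy.1.2⟩
    · intro y hy
      obtain ⟨-, hy1, hy2⟩ := Finset.mem_filter.1 hy
      refine card_conjugators_le h2 h4 fun c hc ↦ ?_
      have hd := y.2
      rw [hc, Matrix.det_smul, Matrix.det_one, mul_one, Fintype.card_fin, sq_eq_one_iff] at hd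
      rcases hd with rfl | rfl
      · exact hy1 (Subtype.ext (by rw [hc]; simp))
      · exact hy2 (Subtype.ext (by rw [hc]; simp))
  set q := Fintype.card F with hq
  have hq2 : 2 ≤ q := Fintype.one_lt_card
  have hB2 : (B ^ 2).card ≤ (B ^ 26).card :=
    Finset.card_le_card (Finset.pow_subset_pow_right h1 (by norm_num))
  have hqn : q ^ 2 * n ≤ 16 * (B ^ 26).card := by
    have h3 : q * (q ^ 2 * n) ≤ q * (16 * (B ^ 26).card) := by
      calc q * (q ^ 2 * n) ≤ (2 * (q - 1)) * (q ^ 2 * (2 * (n - 2))) := by gcongr <;> omega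
        _ = 4 * ((q - 1) * q ^ 2 * (n - 2)) := by ring
        _ ≤ 4 * (Fintype.card SL(2, F) * (n - 2)) := by
          gcongr
          exact le_card_specialLinearGroup
        _ ≤ 4 * ((B ^ 2).card * (4 * q)) := by gcongr
        _ ≤ 4 * ((B ^ 26).card * (4 * q)) := by gcongr
        _ = q * (16 * (B ^ 26).card) := by ring
    exact Nat.le_of_mul_le_mul_left h3 (by omega)
  calc q ^ 6 * B.card ^ 3 ≤ q ^ 6 * (n ^ 3 * (4096 * (B ^ 26).card ^ 2)) := by gcongr
    _ = (q ^ 2 * n) ^ 3 * (4096 * (B ^ 26).card ^ 2) := by ring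
    _ ≤ (16 * (B ^ 26).card) ^ 3 * (4096 * (B ^ 26).card ^ 2) := by gcongr
    _ = 2 ^ 24 * (B ^ 26).card ^ 5 := by ring

end Pivot

/-! ### From small tripling to the symmetrized set. -/

section Symmetrization

variable {G : Type*} [Group G] [DecidableEq G]

theorem union_inv_inv (A : Finset G) : (A ∪ A⁻¹)⁻¹ = A ∪ A⁻¹ := by
  ext x
  simp [or_comm]

/-- Expand the cube into eight products with signs and bound each by the alternating form of the
small tripling inequality. -/
theorem card_union_inv_pow_three_le {A : Finset G} {K : ℝ}
    (hK : ((A ^ 3).card : ℝ) ≤ K * A.card) :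
    (((A ∪ A⁻¹) ^ 3).card : ℝ) ≤ 8 * K ^ 3 * A.card := by
  have hsub : (A ∪ A⁻¹) ^ 3 ⊆ (Finset.univ : Finset (Fin 3 → Bool)).biUnion fun s ↦
      ((List.finRange 3).map fun i ↦ A ^ (if s i then (1 : ℤ) else -1)).prod := by
    intro x hx
    rw [pow_succ, sq] at hx
    obtain ⟨y, hy, c, hc, rfl⟩ := Finset.mem_mul.1 hx
    obtain ⟨a, ha, b, hb, rfl⟩ := Finset.mem_mul.1 hy
    have key : ∀ z ∈ A ∪ A⁻¹, ∃ s : Bool, z ∈ A ^ (if s then (1 : ℤ) else -1) := by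
      intro z hz
      rcases Finset.mem_union.1 hz with h | h
      · exact ⟨true, by simpa using h⟩
      · exact ⟨false, by simpa using h⟩
    obtain ⟨s, hs⟩ := key a ha
    obtain ⟨t, ht⟩ := key b hb
    obtain ⟨u, hu⟩ := key c hc
    refine Finset.mem_biUnion.2 ⟨![s, t, u], Finset.mem_univ _, ?_⟩
    simp only [List.finRange_succ, List.finRange_zero, List.map_nil, List.map_cons,
      List.prod_cons, List.prod_nil, mul_one]
    rw [mul_assoc]
    exact Finset.mul_mem_mul hs (Finset.mul_mem_mul ht hu)
  have h8 : ∀ s : Fin 3 → Bool,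
      ((((List.finRange 3).map fun i ↦ A ^ (if s i then (1 : ℤ) else -1)).prod).card : ℝ)
        ≤ K ^ 3 * A.card := by
    intro s
    have := Finset.small_alternating_pow_of_small_tripling (m := 3) le_rfl hK
      (fun i ↦ if s i then (1 : ℤ) else -1) (fun i ↦ by split_ifs <;> simp)
    simpa using this
  calc (((A ∪ A⁻¹) ^ 3).card : ℝ)
      ≤ (∑ s : Fin 3 → Bool,
        (((List.finRange 3).map fun i ↦ A ^ (if s i then (1 : ℤ) else -1)).prod).card : ℕ) := by
        exact_mod_cast (Finset.card_le_card hsub).trans Finset.card_biUnion_le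
    _ = ∑ s : Fin 3 → Bool,
        ((((List.finRange 3).map fun i ↦ A ^ (if s i then (1 : ℤ) else -1)).prod).card : ℝ) := by
        push_cast; rfl
    _ ≤ ∑ _s : Fin 3 → Bool, K ^ 3 * (A.card : ℝ) := Finset.sum_le_sum fun s _ ↦ h8 s
    _ = 8 * K ^ 3 * A.card := by simp; ring

theorem mem_pow_of_mem_insert_one_pow {B : Finset G} {m : ℕ} {x : G} (hx : x ∈ (insert 1 B) ^ m) :
    ∃ j ≤ m, x ∈ B ^ j := by
  induction m generalizing x with
  | zero => exact ⟨0, le_rfl, by simpa using hx⟩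
  | succ m ih =>
    rw [pow_succ] at hx
    obtain ⟨y, hy, b, hb, rfl⟩ := Finset.mem_mul.1 hx
    obtain ⟨j, hj, hyj⟩ := ih hy
    rcases Finset.mem_insert.1 hb with rfl | hb
    · exact ⟨j, by omega, by simpa using hyj⟩
    · exact ⟨j + 1, by omega, by rw [pow_succ]; exact Finset.mul_mem_mul hyj hb⟩

theorem card_insert_one_pow_le {B : Finset G} (hB : B.Nonempty) (m : ℕ) :
    ((insert 1 B) ^ m).card ≤ (m + 1) * (B ^ m).card := by
  have hsub : (insert 1 B) ^ m ⊆ (Finset.range (m + 1)).biUnion fun j ↦ B ^ j := by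
    intro x hx
    obtain ⟨j, hj, h⟩ := mem_pow_of_mem_insert_one_pow hx
    exact Finset.mem_biUnion.2 ⟨j, Finset.mem_range.2 (by omega), h⟩
  refine (Finset.card_le_card hsub).trans ?_
  refine (Finset.card_biUnion_le_card_mul _ _ (B ^ m).card fun j hj ↦ ?_).trans (by simp)
  have hj : j ≤ m := Nat.lt_succ_iff.1 (Finset.mem_range.1 hj)
  rcases Nat.eq_zero_or_pos j with rfl | hj0
  · rw [pow_zero, Finset.card_one]
    exact Finset.card_pos.2 hB.pow
  · exact hB.card_pow_mono hj

/-- Small tripling controls the powers of the symmetrized set. -/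
theorem card_symmetrized_pow_le {A : Finset G} (hA : A.Nonempty) {K : ℝ}
    (hK : ((A ^ 3).card : ℝ) ≤ K * A.card) {m : ℕ} (hm : 3 ≤ m) :
    (((insert 1 (A ∪ A⁻¹)) ^ m).card : ℝ) ≤ 2 * (m + 1) * (8 * K ^ 3) ^ (m - 2) * A.card := by
  have hpos : (0 : ℝ) < A.card := by exact_mod_cast Finset.card_pos.2 hA
  have hK0 : 0 ≤ K := nonneg_of_mul_nonneg_left (hK.trans' (Nat.cast_nonneg _)) hpos
  have hAB : (A.card : ℝ) ≤ (A ∪ A⁻¹).card := by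
    exact_mod_cast Finset.card_le_card Finset.subset_union_left
  have hBA : ((A ∪ A⁻¹).card : ℝ) ≤ 2 * A.card := by
    have := Finset.card_union_le A A⁻¹
    rw [Finset.card_inv] at this
    exact_mod_cast this.trans (by omega)
  have h3 : (((A ∪ A⁻¹) ^ 3).card : ℝ) ≤ (8 * K ^ 3) * (A ∪ A⁻¹).card :=
    (card_union_inv_pow_three_le hK).trans (by gcongr)
  have hp := Finset.small_pow_of_small_tripling hm h3 (union_inv_inv A)
  have hone : (((insert 1 (A ∪ A⁻¹)) ^ m).card : ℝ) ≤ (m + 1) * ((A ∪ A⁻¹) ^ m).card := by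
    exact_mod_cast card_insert_one_pow_le (hA.mono Finset.subset_union_left) m
  calc (((insert 1 (A ∪ A⁻¹)) ^ m).card : ℝ) ≤ (m + 1) * ((A ∪ A⁻¹) ^ m).card := hone
    _ ≤ (m + 1) * ((8 * K ^ 3) ^ (m - 2) * (2 * A.card)) := by
      gcongr
      exact hp.trans (by gcongr)
    _ = 2 * (m + 1) * (8 * K ^ 3) ^ (m - 2) * A.card := by ring

end Symmetrization

/-! ### Growth in terms of the tripling constant. -/

section Growth

/-- Either the tripling constant `K` of a generating set is large, or the set is. -/
theorem exists_tripling_bound : ∃ C : ℝ, 1 ≤ C ∧ ∀ (p : ℕ) [Fact p.Prime]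
    (A : Finset SL(2, ZMod p)), Subgroup.closure (A : Set SL(2, ZMod p)) = ⊤ → A.Nonempty →
    ∀ K : ℝ, 1 ≤ K → ((A ^ 3).card : ℝ) ≤ K * A.card →
      (A.card : ℝ) ≤ C * K ^ 360 ∨ (p : ℝ) ^ 6 ≤ C * K ^ 360 * (A.card : ℝ) ^ 2 := by
  refine ⟨2 ^ 24 * (54 * 8 ^ 24) ^ 5, by norm_num, ?_⟩
  intro p _ A hgen hA K hK1 hK
  have hsmall : ∀ x : ℝ, x ≤ 81 → x ≤ 2 ^ 24 * (54 * 8 ^ 24) ^ 5 * K ^ 360 := by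
    intro x hx
    refine hx.trans ?_
    have : (1 : ℝ) ≤ K ^ 360 := one_le_pow₀ hK1
    linarith
  have hpos : (0 : ℝ) < A.card := by exact_mod_cast Finset.card_pos.2 hA
  by_cases hp2 : p = 2
  -- Characteristic two is excluded from the trace argument, but there the group itself has at most
  -- `16` elements.
  · left
    apply hsmall
    subst hp2
    have h1 : A.card ≤ Fintype.card SL(2, ZMod 2) := Finset.card_le_univ A
    have h2 := Fintype.card_le_of_injective (fun (g : SL(2, ZMod 2)) i j ↦ g.1 i j)
      fun a b h ↦ Subtype.ext (Matrix.ext fun i j ↦ congrFun₂ h i j)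
    have h3 : Fintype.card (Fin 2 → Fin 2 → ZMod 2) = 16 := by simp
    have : A.card ≤ 81 := by omega
    exact_mod_cast this
  have h2 : (2 : ZMod p) ≠ 0 := by
    intro h
    have h' : ((2 : ℕ) : ZMod p) = 0 := by exact_mod_cast h
    rw [ZMod.natCast_eq_zero_iff] at h'
    exact hp2 ((Nat.prime_dvd_prime_iff_eq Fact.out Nat.prime_two).1 h')
  set B := insert 1 (A ∪ A⁻¹) with hB
  have hAB : A ⊆ B := Finset.subset_union_left.trans (Finset.subset_insert _ _)
  have hABc : (A.card : ℝ) ≤ B.card := by exact_mod_cast Finset.card_le_card hAB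
  have hinv : B⁻¹ = B := by
    rw [hB, Finset.inv_insert, inv_one, union_inv_inv]
  have hgenB : Subgroup.closure (B : Set SL(2, ZMod p)) = ⊤ := by
    rw [eq_top_iff, ← hgen]
    exact Subgroup.closure_mono (Finset.coe_subset.2 hAB)
  have hN := card_symmetrized_pow_le hA hK (m := 26) (by norm_num)
  rw [← hB] at hN
  -- Here `54 = 2 * 27` and `72 = 3 * 24`; the fifth power of `N` in the last alternative turns `72`
  -- into `360`.
  have hN' : ((B ^ 26).card : ℝ) ≤ 54 * 8 ^ 24 * K ^ 72 * A.card := by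
    refine hN.trans (le_of_eq ?_)
    rw [mul_pow, ← pow_mul]
    push_cast
    ring
  rcases growth_trichotomy h2 (Finset.mem_insert_self _ _) hinv hgenB with h | h | h
  · left
    apply hsmall
    exact hABc.trans (by exact_mod_cast h)
  · left
    have h' : (B.card : ℝ) ^ 3 ≤ 2 ^ 21 * ((B ^ 26).card : ℝ) ^ 2 := by exact_mod_cast h
    clear h hN hsmall
    have hN0 : (0 : ℝ) ≤ (B ^ 26).card := Nat.cast_nonneg _
    generalize ((B ^ 26).card : ℝ) = N at hN' h' hN0
    generalize (B.card : ℝ) = b at hABc h'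
    generalize (A.card : ℝ) = a at hN' hABc hpos ⊢
    have h3 : a ^ 2 * a ≤ a ^ 2 * (2 ^ 21 * (54 * 8 ^ 24) ^ 2 * K ^ 144) := by
      calc a ^ 2 * a = a ^ 3 := by ring
        _ ≤ b ^ 3 := by gcongr
        _ ≤ 2 ^ 21 * N ^ 2 := h'
        _ ≤ 2 ^ 21 * (54 * 8 ^ 24 * K ^ 72 * a) ^ 2 := by gcongr
        _ = a ^ 2 * (2 ^ 21 * (54 * 8 ^ 24) ^ 2 * K ^ 144) := by ring
    refine (le_of_mul_le_mul_left h3 (by positivity)).trans ?_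
    have hexp : K ^ 144 ≤ K ^ 360 := pow_le_pow_right₀ hK1 (by norm_num)
    exact mul_le_mul (by norm_num) hexp (by positivity) (by norm_num)
  · right
    rw [ZMod.card] at h
    have h' : (p : ℝ) ^ 6 * (B.card : ℝ) ^ 3 ≤ 2 ^ 24 * ((B ^ 26).card : ℝ) ^ 5 := by
      exact_mod_cast h
    clear h hN hsmall
    have hN0 : (0 : ℝ) ≤ (B ^ 26).card := Nat.cast_nonneg _
    generalize ((B ^ 26).card : ℝ) = N at hN' h' hN0
    generalize (B.card : ℝ) = b at hABc h'
    generalize (A.card : ℝ) = a at hN' hABc hpos ⊢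
    have h3 : a ^ 3 * (p : ℝ) ^ 6 ≤ a ^ 3 * (2 ^ 24 * (54 * 8 ^ 24) ^ 5 * K ^ 360 * a ^ 2) := by
      calc a ^ 3 * (p : ℝ) ^ 6 = (p : ℝ) ^ 6 * a ^ 3 := by ring
        _ ≤ (p : ℝ) ^ 6 * b ^ 3 := by gcongr
        _ ≤ 2 ^ 24 * N ^ 5 := h'
        _ ≤ 2 ^ 24 * (54 * 8 ^ 24 * K ^ 72 * a) ^ 5 := by gcongr
        _ = a ^ 3 * (2 ^ 24 * (54 * 8 ^ 24) ^ 5 * K ^ 360 * a ^ 2) := by ring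
    exact le_of_mul_le_mul_left h3 (by positivity)

theorem exists_growth_constants {δ : ℝ} (hδ : 0 < δ) : ∃ c : ℝ, 0 < c ∧ ∃ ε : ℝ, 0 < ε ∧
    ∀ (p : ℕ) [Fact p.Prime] (A : Finset SL(2, ZMod p)),
      Subgroup.closure (A : Set SL(2, ZMod p)) = ⊤ → A.Nonempty →
      (A.card : ℝ) < (p : ℝ) ^ (3 - δ) → c * (A.card : ℝ) ^ (1 + ε) < ((A ^ 3).card : ℝ) := by
  obtain ⟨C, hC, h⟩ := exists_tripling_bound
  -- Lowering `δ` only weakens the size condition; the cap gives `η / 2 ≤ 1` for the small-set case.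
  set η := min δ 1 with hη
  have hη0 : 0 < η := lt_min hδ one_pos
  have hη1 : η ≤ 1 := min_le_right _ _
  refine ⟨1 / (2 * C), by positivity, η / 720, by positivity, ?_⟩
  intro p hp A hgen hA hcard
  have hp1 : (1 : ℝ) ≤ p := by exact_mod_cast hp.out.one_lt.le
  have hcard' : (A.card : ℝ) < (p : ℝ) ^ (3 - η) :=
    hcard.trans_le (Real.rpow_le_rpow_of_exponent_le hp1 (by linarith [min_le_left δ 1]))
  have hA1 : (1 : ℝ) ≤ A.card := by exact_mod_cast Finset.card_pos.2 hA
  have hpos : (0 : ℝ) < A.card := by linarith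
  obtain ⟨K, hKA, hK1⟩ : ∃ K : ℝ, ((A ^ 3).card : ℝ) = K * A.card ∧ 1 ≤ K := by
    refine ⟨((A ^ 3).card : ℝ) / A.card, (div_mul_cancel₀ _ hpos.ne').symm, ?_⟩
    rw [le_div_iff₀ hpos, one_mul]
    exact_mod_cast Finset.card_le_card_pow (by norm_num)
  have hdich := h p A hgen hA K hK1 hKA.le
  rw [hKA]
  clear hKA hcard h hgen hA
  generalize (A.card : ℝ) = a at hdich hA1 hpos hcard' ⊢
  have hmain : a ^ (η / 2) ≤ C * K ^ 360 := by
    rcases hdich with h | h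
    · calc a ^ (η / 2) ≤ a ^ (1 : ℝ) := Real.rpow_le_rpow_of_exponent_le hA1 (by linarith)
        _ = a := Real.rpow_one _
        _ ≤ _ := h
    -- The surplus comes from `(3 - η) * (2 + η / 2) = 6 - η / 2 - η ^ 2 / 2`. Taking a `360`th root
    -- later gives the exponent `η / 720`.
    · have h6 : a ^ (2 + η / 2) ≤ (p : ℝ) ^ 6 := by
        calc a ^ (2 + η / 2) ≤ ((p : ℝ) ^ (3 - η)) ^ (2 + η / 2) :=
              Real.rpow_le_rpow hpos.le hcard'.le (by positivity)
          _ = (p : ℝ) ^ ((3 - η) * (2 + η / 2)) := by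
              rw [Real.rpow_mul (by positivity)]
          _ ≤ (p : ℝ) ^ ((6 : ℕ) : ℝ) :=
              Real.rpow_le_rpow_of_exponent_le hp1 (by push_cast; nlinarith)
          _ = (p : ℝ) ^ 6 := Real.rpow_natCast _ _
      have h7 := h6.trans h
      rw [Real.rpow_add hpos, mul_comm, Real.rpow_two] at h7
      exact le_of_mul_le_mul_right h7 (by positivity)
  have hCpos : 0 < C := by linarith
  have hKlow : a ^ (η / 720) ≤ C * K := by
    have hx : (a ^ (η / 720)) ^ 360 ≤ (C * K) ^ 360 := by
      rw [← Real.rpow_natCast, ← Real.rpow_mul hpos.le, mul_pow]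
      have e : η / 720 * ((360 : ℕ) : ℝ) = η / 2 := by push_cast; ring
      rw [e]
      refine hmain.trans ?_
      gcongr
      exact le_self_pow₀ hC (by norm_num)
    exact le_of_pow_le_pow_left₀ (by norm_num) (by positivity) hx
  rw [Real.rpow_add hpos, Real.rpow_one]
  calc 1 / (2 * C) * (a * a ^ (η / 720)) ≤ 1 / (2 * C) * (a * (C * K)) := by gcongr
    _ = K * a / 2 := by field_simp
    _ < K * a := by
      have : 0 < K * a := by positivity
      linarith

end Growth

/-! ### Incidences and sums of products over a finite field. -/

section SumProduct

variable {F : Type*} [Field F] [Fintype F] [DecidableEq F]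

theorem card_line_eq {w : F × F} (hw : w.1 ≠ 0) (c : F) :
    (Finset.univ.filter fun v : F × F ↦ v.1 * w.1 + v.2 * w.2 = c).card = Fintype.card F := by
  rw [← Finset.card_univ]
  refine Finset.card_bij (fun v _ ↦ v.2) (fun _ _ ↦ Finset.mem_univ _) ?_ ?_
  · rintro ⟨a, b⟩ h ⟨a', b'⟩ h' hb
    simp only [Finset.mem_filter, Finset.mem_univ, true_and] at h h' hb
    subst hb
    rw [mul_right_cancel₀ hw (add_right_cancel (h.trans h'.symm))]
  · intro b _
    refine ⟨((c - b * w.2) / w.1, b), ?_, rfl⟩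
    simp only [Finset.mem_filter, Finset.mem_univ, true_and]
    field_simp
    ring

theorem card_two_lines_le {w w' : F × F} (hw : w.1 ≠ 0) (hww' : w ≠ w') {c : F} (hc : c ≠ 0) :
    (Finset.univ.filter fun v : F × F ↦ v.1 * w.1 + v.2 * w.2 = c ∧
      v.1 * w'.1 + v.2 * w'.2 = c).card ≤ 1 := by
  rw [Finset.card_le_one]
  rintro ⟨a, b⟩ h ⟨a', b'⟩ h'
  simp only [Finset.mem_filter, Finset.mem_univ, true_and] at h h'
  have hD : w.1 * w'.2 - w.2 * w'.1 ≠ 0 := by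
    intro hD
    apply hww'
    have e1 : w.1 = w'.1 := mul_right_cancel₀ hc (by
      linear_combination -w.1 * h.2 + w'.1 * h.1 + b * hD)
    have e2 : w.2 = w'.2 := mul_left_cancel₀ hw (by rw [← e1] at hD; linear_combination -hD)
    exact Prod.ext e1 e2
  have e1 : a = a' := mul_right_cancel₀ hD (by
    linear_combination w'.2 * h.1 - w'.2 * h'.1 - w.2 * h.2 + w.2 * h'.2)
  have e2 : b = b' := mul_right_cancel₀ hD (by
    linear_combination w.1 * h.2 - w.1 * h'.2 - w'.1 * h.1 + w'.1 * h'.1)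
  rw [e1, e2]

/-- Large sets of points and lines in the plane over a finite field are incident. -/
theorem exists_incidence {V W : Finset (F × F)} (hW : ∀ w ∈ W, w.1 ≠ 0)
    (hcard : Fintype.card F ^ 3 < V.card * W.card) {c : F} (hc : c ≠ 0) :
    ∃ v ∈ V, ∃ w ∈ W, v.1 * w.1 + v.2 * w.2 = c := by
  by_contra! hcon
  set q := Fintype.card F with hq
  let r : F × F → ℕ := fun v ↦ (W.filter fun w ↦ v.1 * w.1 + v.2 * w.2 = c).card
  have hr0 : ∀ v ∈ V, r v = 0 := by
    intro v hv
    rw [Finset.card_eq_zero, Finset.filter_eq_empty_iff]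
    exact fun w hw ↦ hcon v hv w hw
  have hsum : ∑ v, r v = q * W.card := by
    have := Finset.sum_card_bipartiteAbove_eq_sum_card_bipartiteBelow
      (s := (Finset.univ : Finset (F × F))) (t := W)
      (fun v w : F × F ↦ v.1 * w.1 + v.2 * w.2 = c)
    simp only [Finset.bipartiteAbove, Finset.bipartiteBelow] at this
    rw [show ∑ v, r v = _ from this, Finset.sum_congr rfl fun w hw ↦ card_line_eq (hW w hw) c]
    simp [mul_comm, hq]
  have hsq : ∑ v, r v ^ 2 ≤ q * W.card + W.card ^ 2 := by
    have hswap := Finset.sum_card_bipartiteAbove_eq_sum_card_bipartiteBelow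
      (s := (Finset.univ : Finset (F × F))) (t := W ×ˢ W)
      (fun (v : F × F) (ww : (F × F) × (F × F)) ↦ v.1 * ww.1.1 + v.2 * ww.1.2 = c ∧
        v.1 * ww.2.1 + v.2 * ww.2.2 = c)
    simp only [Finset.bipartiteAbove, Finset.bipartiteBelow] at hswap
    have hr2 : ∀ v, r v ^ 2 = ((W ×ˢ W).filter fun ww ↦ v.1 * ww.1.1 + v.2 * ww.1.2 = c ∧
        v.1 * ww.2.1 + v.2 * ww.2.2 = c).card := by
      intro v
      rw [sq, ← Finset.card_product,
        ← Finset.filter_product (fun w : F × F ↦ v.1 * w.1 + v.2 * w.2 = c)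
          (fun w : F × F ↦ v.1 * w.1 + v.2 * w.2 = c)]
    rw [Finset.sum_congr rfl fun v _ ↦ hr2 v, hswap]
    calc _ ≤ ∑ ww ∈ W ×ˢ W, (1 + if ww.1 = ww.2 then q else 0) := by
          refine Finset.sum_le_sum fun ww hww ↦ ?_
          have hw := hW _ (Finset.mem_product.1 hww).1
          split_ifs with h
          · refine le_trans (Finset.card_le_card ?_)
              ((card_line_eq hw c).le.trans (Nat.le_add_left _ _))
            exact Finset.monotone_filter_right _ fun v _ hv ↦ hv.1
          · exact card_two_lines_le hw h hc
      _ = q * W.card + W.card ^ 2 := by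
          rw [Finset.sum_product]
          simp only [Finset.sum_add_distrib, Finset.sum_ite_eq, Finset.sum_const, smul_eq_mul,
            mul_one]
          rw [Finset.sum_congr rfl fun w hw ↦ if_pos hw]
          simp
          ring
  -- Without incidences, all the mass of `r` sits off `V`; Cauchy–Schwarz there contradicts the
  -- second moment bound.
  have hcs := sq_sum_le_card_mul_sum_sq (s := Vᶜ) (f := r)
  have hcompl : ∑ v ∈ Vᶜ, r v = q * W.card := by
    rw [← hsum, ← Finset.sum_compl_add_sum V, Finset.sum_eq_zero hr0, add_zero]
  have hcompl2 : ∑ v ∈ Vᶜ, r v ^ 2 ≤ q * W.card + W.card ^ 2 :=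
    (Finset.sum_le_sum_of_subset (Finset.subset_univ _)).trans hsq
  have hm : Vᶜ.card + V.card = q ^ 2 := by
    rw [Finset.card_compl_add_card, Fintype.card_prod, sq]
  rw [hcompl] at hcs
  have hW0 : 0 < W.card := by
    rcases Nat.eq_zero_or_pos W.card with h | h
    · rw [h, mul_zero] at hcard
      exact absurd hcard (Nat.not_lt_zero _)
    · exact h
  generalize Vᶜ.card = m at hm hcs
  generalize V.card = v at hm hcard
  generalize W.card = w at hcs hcompl2 hcard hW0
  have h1 : w * (q ^ 2 * w) ≤ w * (m * (q + w)) := by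
    calc w * (q ^ 2 * w) = (q * w) ^ 2 := by ring
      _ ≤ m * (q * w + w ^ 2) := hcs.trans (Nat.mul_le_mul_left _ hcompl2)
      _ = w * (m * (q + w)) := by ring
  have h2 := Nat.le_of_mul_le_mul_left h1 hW0
  have h3 : m * q ≤ q ^ 3 := by
    rw [pow_succ]
    exact Nat.mul_le_mul_right _ (by omega)
  rw [← hm] at h2
  nlinarith

theorem exists_eq_mul_add_mul {X Y : Finset F} (hY : 0 ∉ Y)
    (hcard : Fintype.card F ^ 3 < (X.card * Y.card) ^ 2) {c : F} (hc : c ≠ 0) :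
    ∃ x₁ ∈ X, ∃ x₂ ∈ X, ∃ y₁ ∈ Y, ∃ y₂ ∈ Y, c = x₁ * y₁ + x₂ * y₂ := by
  obtain ⟨v, hv, w, hw, h⟩ := exists_incidence (V := X ×ˢ X) (W := Y ×ˢ Y)
    (fun w hw h ↦ hY (h ▸ (Finset.mem_product.1 hw).1))
    (by rw [Finset.card_product, Finset.card_product]; calc
      _ < _ := hcard
      _ = _ := by ring) hc
  rw [Finset.mem_product] at hv hw
  exact ⟨v.1, hv.1, v.2, hv.2, w.1, hw.1, w.2, hw.2, h.symm⟩

end SumProduct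

/-! ### Unipotent matrices. -/

section LargeSets

variable {F : Type*} [Field F]

/-- The upper unipotent matrix with off-diagonal entry `x`. -/
def upperUnipotent (x : F) : SL(2, F) := ⟨!![1, x; 0, 1], by simp⟩

/-- The lower unipotent matrix with off-diagonal entry `x`. -/
def lowerUnipotent (x : F) : SL(2, F) := ⟨!![1, 0; x, 1], by simp⟩

theorem upperUnipotent_coe (x : F) : (upperUnipotent x).1 = !![1, x; 0, 1] := rfl

theorem lowerUnipotent_coe (x : F) : (lowerUnipotent x).1 = !![1, 0; x, 1] := rfl

theorem upperUnipotent_add (x y : F) :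
    upperUnipotent (x + y) = upperUnipotent x * upperUnipotent y := by
  ext i j
  fin_cases i <;> fin_cases j <;> simp [upperUnipotent_coe, add_comm]

theorem eq_upperUnipotent {g : SL(2, F)} (h0 : g.1 0 0 = 1) (h1 : g.1 1 0 = 0) :
    g = upperUnipotent (g.1 0 1) := by
  have hd := g.2
  rw [Matrix.det_fin_two, h0, h1] at hd
  have h11 : g.1 1 1 = 1 := by linear_combination hd
  apply Subtype.ext
  rw [Matrix.eta_fin_two g.1, h0, h1, h11]
  simp [upperUnipotent_coe]

theorem conj_upperUnipotent {b : SL(2, F)} (hb : b.1 1 0 = 0) (x : F) :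
    b * upperUnipotent x * b⁻¹ = upperUnipotent (x * b.1 0 0 ^ 2) := by
  have hd := b.2
  rw [Matrix.det_fin_two, hb] at hd
  rw [mul_inv_eq_iff_eq_mul]
  apply Subtype.ext
  rw [Matrix.SpecialLinearGroup.coe_mul, Matrix.SpecialLinearGroup.coe_mul]
  ext i j
  fin_cases i <;> fin_cases j <;>
    simp [upperUnipotent_coe, Matrix.mul_apply, hb]
  linear_combination -x * b.1 0 0 * hd

/-- Three factors suffice when the lower left entry is nonzero; otherwise left multiplication by a
lower unipotent makes it so. -/
theorem exists_eq_unipotent_mul (g : SL(2, F)) : ∃ w x y z : F,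
    g = lowerUnipotent w * upperUnipotent x * lowerUnipotent y * upperUnipotent z := by
  have key : ∀ g : SL(2, F), g.1 1 0 ≠ 0 →
      ∃ x y z : F, g = upperUnipotent x * lowerUnipotent y * upperUnipotent z := by
    intro g hg
    have hd := g.2
    rw [Matrix.det_fin_two] at hd
    refine ⟨(g.1 0 0 - 1) / g.1 1 0, g.1 1 0, (g.1 1 1 - 1) / g.1 1 0, ?_⟩
    apply Subtype.ext
    rw [Matrix.SpecialLinearGroup.coe_mul, Matrix.SpecialLinearGroup.coe_mul]
    ext i j
    fin_cases i <;> fin_cases j <;>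
      simp [upperUnipotent_coe, lowerUnipotent_coe, Matrix.mul_apply] <;> field_simp
    · ring
    · linear_combination -hd
    · ring
  by_cases hg : g.1 1 0 = 0
  · have hd := g.2
    rw [Matrix.det_fin_two, hg] at hd
    obtain ⟨x, y, z, h⟩ := key (lowerUnipotent 1 * g) (by
      simp [lowerUnipotent_coe, Matrix.mul_apply, hg]
      intro h0
      simp [h0] at hd)
    refine ⟨-1, x, y, z, ?_⟩
    have h1 : lowerUnipotent (-1 : F) * lowerUnipotent 1 = 1 := by
      ext i j
      fin_cases i <;> fin_cases j <;> simp [lowerUnipotent_coe]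
    rw [mul_assoc, mul_assoc, ← mul_assoc (upperUnipotent x), ← h, ← mul_assoc, h1, one_mul]
  · obtain ⟨x, y, z, h⟩ := key g hg
    have h1 : lowerUnipotent (0 : F) = 1 := by
      ext i j
      fin_cases i <;> fin_cases j <;> simp [lowerUnipotent_coe]
    exact ⟨0, x, y, z, by rw [h1, one_mul, ← h]⟩

end LargeSets

/-! ### Large symmetric sets fill the group in boundedly many steps. -/

section LargeSetsGenerate

variable {F : Type*} [Field F]

theorem inv_mul_apply_zero_zero (g h : SL(2, F)) :
    (g⁻¹ * h).1 0 0 = g.1 1 1 * h.1 0 0 - g.1 0 1 * h.1 1 0 := by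
  rw [Matrix.SpecialLinearGroup.coe_mul, Matrix.SpecialLinearGroup.coe_inv,
    Matrix.adjugate_fin_two, Matrix.mul_apply, Fin.sum_univ_two]
  simp
  ring

theorem inv_mul_apply_one_zero (g h : SL(2, F)) :
    (g⁻¹ * h).1 1 0 = g.1 0 0 * h.1 1 0 - g.1 1 0 * h.1 0 0 := by
  rw [Matrix.SpecialLinearGroup.coe_mul, Matrix.SpecialLinearGroup.coe_inv,
    Matrix.adjugate_fin_two, Matrix.mul_apply, Fin.sum_univ_two]
  simp
  ring

variable [Fintype F] [DecidableEq F]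

/-- Pigeonhole on the first column: two matrices sharing it differ by an upper unipotent. -/
theorem card_le_card_unipotent_mul (A : Finset SL(2, F)) :
    A.card ≤ (Finset.univ.filter fun x : F ↦ upperUnipotent x ∈ A⁻¹ * A).card *
      Fintype.card F ^ 2 := by
  rw [sq, ← Fintype.card_prod, ← Finset.card_univ]
  refine Finset.card_le_mul_card_image_of_maps_to (f := fun g : SL(2, F) ↦ (g.1 0 0, g.1 1 0))
    (fun _ _ ↦ Finset.mem_univ _) _ fun ac _ ↦ ?_
  rcases (A.filter fun g : SL(2, F) ↦ (g.1 0 0, g.1 1 0) = ac).eq_empty_or_nonempty with h | ⟨k, hk⟩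
  · rw [h]; exact Nat.zero_le _
  obtain ⟨hkA, rfl⟩ := Finset.mem_filter.1 hk
  have hu : ∀ g ∈ A.filter fun g : SL(2, F) ↦ (g.1 0 0, g.1 1 0) = (k.1 0 0, k.1 1 0),
      k⁻¹ * g = upperUnipotent ((k⁻¹ * g).1 0 1) := by
    intro g hg
    obtain ⟨hgA, hg⟩ := Finset.mem_filter.1 hg
    rw [Prod.mk.injEq] at hg
    have hd := k.2
    rw [Matrix.det_fin_two] at hd
    refine eq_upperUnipotent ?_ ?_
    · rw [inv_mul_apply_zero_zero, hg.1, hg.2]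
      linear_combination hd
    · rw [inv_mul_apply_one_zero, hg.1, hg.2]
      ring
  refine Finset.card_le_card_of_injOn (fun g ↦ (k⁻¹ * g).1 0 1) ?_ ?_
  · intro g hg
    refine Finset.mem_coe.2 (Finset.mem_filter.2 ⟨Finset.mem_univ _, ?_⟩)
    rw [← hu g hg]
    exact Finset.mul_mem_mul (Finset.inv_mem_inv hkA) (Finset.mem_filter.1 hg).1
  · intro g hg g' hg' h
    have e : k⁻¹ * g = k⁻¹ * g' := by
      rw [hu g hg, hu g' hg']
      exact congrArg _ h
    exact mul_left_cancel e

/-- Pigeonhole on the slope of the first column, one of `q + 1` points of the projective line, gives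
triangular quotients. Each diagonal entry accounts for at most `q` of them, and squaring is at most
two-to-one. -/
theorem card_le_card_diagonal_mul (A : Finset SL(2, F)) :
    A.card ≤ (((A⁻¹ * A).filter fun g ↦ g.1 1 0 = 0).image fun g ↦ g.1 0 0 ^ 2).card *
      (4 * Fintype.card F ^ 2) := by
  set D := (A⁻¹ * A).filter fun g ↦ g.1 1 0 = 0 with hD
  set q := Fintype.card F with hq
  have hq1 : 1 ≤ q := Fintype.card_pos
  have hA : A.card ≤ D.card * (q + 1) := by
    have hO : (Finset.univ : Finset (Option F)).card = q + 1 := by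
      rw [Finset.card_univ, Fintype.card_option]
    rw [← hO]
    refine Finset.card_le_mul_card_image_of_maps_to
      (f := fun g : SL(2, F) ↦ if g.1 0 0 = 0 then none else some (g.1 1 0 / g.1 0 0))
      (fun _ _ ↦ Finset.mem_univ _) _ fun o _ ↦ ?_
    rcases (A.filter fun g : SL(2, F) ↦ (if g.1 0 0 = 0 then none
      else some (g.1 1 0 / g.1 0 0)) = o).eq_empty_or_nonempty with h | ⟨k, hk⟩
    · rw [h]; exact Nat.zero_le _
    obtain ⟨hkA, rfl⟩ := Finset.mem_filter.1 hk
    refine Finset.card_le_card_of_injOn (fun g ↦ k⁻¹ * g) ?_ fun _ _ _ _ h ↦ mul_left_cancel h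
    intro g hg
    obtain ⟨hgA, hg⟩ := Finset.mem_filter.1 hg
    refine Finset.mem_coe.2 (Finset.mem_filter.2
      ⟨Finset.mul_mem_mul (Finset.inv_mem_inv hkA) hgA, ?_⟩)
    rw [inv_mul_apply_one_zero]
    by_cases h1 : g.1 0 0 = 0
    · by_cases h2 : k.1 0 0 = 0
      · rw [h1, h2]; ring
      · simp [h1, h2] at hg
    · by_cases h2 : k.1 0 0 = 0
      · simp [h1, h2] at hg
      · simp only [h1, h2, if_false, Option.some.injEq] at hg
        field_simp at hg
        linear_combination hg
  have hDr : D.card ≤ q * (D.image fun g ↦ g.1 0 0).card := by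
    refine Finset.card_le_mul_card_image (f := fun g : SL(2, F) ↦ g.1 0 0) D q fun r _ ↦ ?_
    rw [hq, ← Finset.card_univ]
    refine Finset.card_le_card_of_injOn (fun g ↦ g.1 0 1) (fun _ _ ↦ Finset.mem_coe.2
      (Finset.mem_univ _)) ?_
    intro g hg g' hg' h
    obtain ⟨hg, hr⟩ := Finset.mem_filter.1 hg
    obtain ⟨hg', hr'⟩ := Finset.mem_filter.1 hg'
    have h10 := (Finset.mem_filter.1 hg).2
    have h10' := (Finset.mem_filter.1 hg').2
    have hd := g.2
    have hd' := g'.2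
    rw [Matrix.det_fin_two, h10, hr] at hd
    rw [Matrix.det_fin_two, h10', hr'] at hd'
    have hr0 : r ≠ 0 := by rintro rfl; simp at hd
    have h11 : g.1 1 1 = g'.1 1 1 := mul_left_cancel₀ hr0 (by linear_combination hd - hd')
    apply Subtype.ext
    rw [Matrix.eta_fin_two g.1, Matrix.eta_fin_two g'.1, hr, hr', h10, h10', h11]
    simp only at h
    rw [h]
  have hr2 : (D.image fun g ↦ g.1 0 0).card ≤ 2 * (D.image fun g ↦ g.1 0 0 ^ 2).card := by
    have e : (D.image fun g ↦ g.1 0 0 ^ 2) = (D.image fun g ↦ g.1 0 0).image fun r ↦ r ^ 2 := by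
      rw [Finset.image_image]; rfl
    rw [e]
    refine Finset.card_le_mul_card_image _ 2 fun s hs ↦ ?_
    obtain ⟨r, -, rfl⟩ := Finset.mem_image.1 hs
    refine (Finset.card_le_card (t := {r, -r}) fun x hx ↦ ?_).trans Finset.card_le_two
    have := (Finset.mem_filter.1 hx).2
    simpa using sq_eq_sq_iff_eq_or_eq_neg.1 this
  calc A.card ≤ D.card * (q + 1) := hA
    _ ≤ (q * (2 * (D.image fun g ↦ g.1 0 0 ^ 2).card)) * (q + q) := by
      gcongr
      exact hDr.trans (Nat.mul_le_mul_left _ hr2)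
    _ = _ := by ring

/-- Conjugating a unipotent by a triangular element multiplies its entry by a square `y` in `Y`; two
such conjugates realize `x₁ * y₁ + x₂ * y₂`, each costing six factors. -/
theorem upperUnipotent_mem_pow {B : Finset SL(2, F)} (h1 : 1 ∈ B) (hinv : B⁻¹ = B)
    (hcard : 16 * Fintype.card F ^ 11 < B.card ^ 4) (c : F) : upperUnipotent c ∈ B ^ 12 := by
  by_cases hc : c = 0
  · have : upperUnipotent c = 1 := by
      rw [hc]
      ext i j
      fin_cases i <;> fin_cases j <;> simp [upperUnipotent_coe]
    rw [this]
    exact Finset.one_mem_pow h1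
  have hX := card_le_card_unipotent_mul B
  have hY := card_le_card_diagonal_mul B
  rw [hinv, ← sq] at hX hY
  set X := Finset.univ.filter fun x : F ↦ upperUnipotent x ∈ B ^ 2 with hXdef
  set Y := ((B ^ 2).filter fun g ↦ g.1 1 0 = 0).image fun g ↦ g.1 0 0 ^ 2 with hYdef
  have hinv2 : (B ^ 2)⁻¹ = B ^ 2 := by rw [← inv_pow, hinv]
  have hY0 : (0 : F) ∉ Y := by
    intro h
    obtain ⟨g, hg, h0⟩ := Finset.mem_image.1 h
    have hd := g.2
    rw [Matrix.det_fin_two, (Finset.mem_filter.1 hg).2, pow_eq_zero_iff two_ne_zero |>.1 h0] at hd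
    simp at hd
  have hXY : Fintype.card F ^ 3 < (X.card * Y.card) ^ 2 := by
    set q := Fintype.card F with hq
    have hq1 : 0 < q := Fintype.card_pos
    have h4 : B.card ^ 4 ≤ (X.card * q ^ 2) ^ 2 * (Y.card * (4 * q ^ 2)) ^ 2 := by
      calc B.card ^ 4 = B.card ^ 2 * B.card ^ 2 := by ring
        _ ≤ _ := by gcongr
    have h5 : (16 * q ^ 8) * q ^ 3 < (16 * q ^ 8) * (X.card * Y.card) ^ 2 := by
      calc (16 * q ^ 8) * q ^ 3 = 16 * q ^ 11 := by ring
        _ < B.card ^ 4 := hcard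
        _ ≤ _ := h4
        _ = (16 * q ^ 8) * (X.card * Y.card) ^ 2 := by ring
    exact Nat.lt_of_mul_lt_mul_left h5
  obtain ⟨x₁, hx₁, x₂, hx₂, y₁, hy₁, y₂, hy₂, rfl⟩ := exists_eq_mul_add_mul hY0 hXY hc
  have key : ∀ x ∈ X, ∀ y ∈ Y, upperUnipotent (x * y) ∈ B ^ 6 := by
    intro x hx y hy
    obtain ⟨b, hb, rfl⟩ := Finset.mem_image.1 hy
    obtain ⟨hb, hb0⟩ := Finset.mem_filter.1 hb
    rw [← conj_upperUnipotent hb0, show B ^ 6 = B ^ 2 * B ^ 2 * B ^ 2 by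
      rw [← pow_add, ← pow_add]]
    refine Finset.mul_mem_mul (Finset.mul_mem_mul hb (Finset.mem_filter.1 hx).2) ?_
    rw [← hinv2]
    exact Finset.inv_mem_inv hb
  rw [upperUnipotent_add, show B ^ 12 = B ^ 6 * B ^ 6 by rw [← pow_add]]
  exact Finset.mul_mem_mul (key _ hx₁ _ hy₁) (key _ hx₂ _ hy₂)

theorem lowerUnipotent_mem_pow {B : Finset SL(2, F)} (h1 : 1 ∈ B) (hinv : B⁻¹ = B)
    (hcard : 16 * Fintype.card F ^ 11 < B.card ^ 4) (c : F) : lowerUnipotent c ∈ B ^ 12 := by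
  let w : SL(2, F) := ⟨!![0, 1; -1, 0], by simp⟩
  let φ : SL(2, F) ≃* SL(2, F) := MulAut.conj w
  have hw : φ (lowerUnipotent c) = upperUnipotent (-c) := by
    rw [MulAut.conj_apply, mul_inv_eq_iff_eq_mul]
    apply Subtype.ext
    rw [Matrix.SpecialLinearGroup.coe_mul, Matrix.SpecialLinearGroup.coe_mul,
      upperUnipotent_coe, lowerUnipotent_coe]
    ext i j
    fin_cases i <;> fin_cases j <;> simp [w]
  have h := upperUnipotent_mem_pow (B := B.image φ) (Finset.mem_image.2 ⟨1, h1, map_one φ⟩)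
    (by
      conv_rhs => rw [← hinv]
      exact (Finset.image_inv φ B).symm)
    (by rwa [Finset.card_image_of_injective _ φ.injective]) (-c)
  rw [← Finset.image_pow φ, ← hw] at h
  obtain ⟨x, hx, hxe⟩ := Finset.mem_image.1 h
  rwa [φ.injective hxe] at hx

theorem pow_eq_univ_of_card {B : Finset SL(2, F)} (h1 : 1 ∈ B) (hinv : B⁻¹ = B)
    (hcard : 16 * Fintype.card F ^ 11 < B.card ^ 4) (g : SL(2, F)) : g ∈ B ^ 48 := by
  have hpow : B ^ 48 = B ^ 12 * B ^ 12 * B ^ 12 * B ^ 12 := by simp only [← pow_add]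
  rw [hpow]
  obtain ⟨w, x, y, z, rfl⟩ := exists_eq_unipotent_mul g
  exact Finset.mul_mem_mul (Finset.mul_mem_mul (Finset.mul_mem_mul
    (lowerUnipotent_mem_pow h1 hinv hcard w) (upperUnipotent_mem_pow h1 hinv hcard x))
    (lowerUnipotent_mem_pow h1 hinv hcard y)) (upperUnipotent_mem_pow h1 hinv hcard z)

end LargeSetsGenerate

/-! ### Iterating growth until the group is filled. -/

section Generation

theorem mem_pow_card_of_closure_eq_top {G : Type*} [Group G] [Fintype G] [DecidableEq G]
    {B : Finset G} (h1 : 1 ∈ B) (hinv : B⁻¹ = B) (hgen : Subgroup.closure (B : Set G) = ⊤) (g : G) :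
    g ∈ B ^ Fintype.card G := by
  have hinv' : ∀ b ∈ B, b⁻¹ ∈ B := fun b hb ↦ by
    rw [← hinv]; exact Finset.inv_mem_inv hb
  have hstab : ∀ k, B ^ k = B ^ (k + 1) → ∀ x, x ∈ B ^ k := by
    intro k hk x
    have hx : x ∈ Subgroup.closure (B : Set G) := by rw [hgen]; trivial
    have hmul : ∀ b ∈ B, ∀ y ∈ B ^ k, b * y ∈ B ^ k := by
      intro b hb y hy
      rw [hk, pow_succ']
      exact Finset.mul_mem_mul hb hy
    induction hx using Subgroup.closure_induction_left with
    | one => exact Finset.one_mem_pow h1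
    | mul_left b hb y _ ih => exact hmul b hb y ih
    | inv_mul_cancel b hb y _ ih => exact hmul _ (hinv' b hb) y ih
  have hcard : ∀ k, (∀ x, x ∈ B ^ k) ∨ k + 1 ≤ (B ^ k).card := by
    intro k
    induction k with
    | zero => right; simp
    | succ k ih =>
      have hsub : B ^ k ⊆ B ^ (k + 1) := Finset.pow_subset_pow_right h1 (Nat.le_succ k)
      by_cases hk : B ^ k = B ^ (k + 1)
      · left
        rw [← hk]
        exact hstab k hk
      · rcases ih with ih | ih
        · exact Or.inl fun x ↦ hsub (ih x)
        · right
          have := Finset.card_lt_card (Finset.ssubset_iff_subset_ne.2 ⟨hsub, hk⟩)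
          omega
  rcases hcard (Fintype.card G) with h | h
  · exact h g
  · have := Finset.card_le_univ (B ^ Fintype.card G)
    omega

theorem exists_list_of_mem_pow {G : Type*} [Group G] [DecidableEq G] {B : Finset G} {k : ℕ} {x : G}
    (hx : x ∈ B ^ k) : ∃ l : List G, l.length = k ∧ (∀ y ∈ l, y ∈ B) ∧ l.prod = x := by
  induction k generalizing x with
  | zero =>
    have h : x = 1 := by simpa using hx
    exact ⟨[], rfl, by simp, by simp [h]⟩
  | succ k ih =>
    rw [pow_succ'] at hx
    obtain ⟨b, hb, y, hy, rfl⟩ := Finset.mem_mul.1 hx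
    obtain ⟨l, hl, hlB, rfl⟩ := ih hy
    exact ⟨b :: l, by simp [hl], by simpa using ⟨hb, hlB⟩, by simp⟩

theorem card_specialLinearGroup_le (p : ℕ) [Fact p.Prime] :
    Fintype.card SL(2, ZMod p) ≤ p ^ 4 := by
  have h := Fintype.card_le_of_injective (fun (g : SL(2, ZMod p)) i j ↦ g.1 i j)
    fun a b h ↦ Subtype.ext (Matrix.ext fun i j ↦ congrFun₂ h i j)
  have h3 : Fintype.card (Fin 2 → Fin 2 → ZMod p) = p ^ 4 := by
    simp [ZMod.card]
    ring
  omega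

/-- Each tripling multiplies the exponent of `p` by `1 + ε / 2`; the other half of the gain `ε`
absorbs `c`, which is what `hp` guarantees. -/
theorem le_card_pow_three_pow {p : ℕ} [Fact p.Prime] {B : Finset SL(2, ZMod p)} (h1 : 1 ∈ B)
    (hgen : Subgroup.closure (B : Set SL(2, ZMod p)) = ⊤) {c ε δ : ℝ} (hε : 0 < ε)
    (hgrow : ∀ A : Finset SL(2, ZMod p), Subgroup.closure (A : Set SL(2, ZMod p)) = ⊤ →
      A.Nonempty → (A.card : ℝ) < (p : ℝ) ^ (3 - 1 / 5 : ℝ) →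
      c * (A.card : ℝ) ^ (1 + ε) < ((A ^ 3).card : ℝ))
    (hB : (p : ℝ) ^ δ ≤ B.card) (hp : 1 ≤ c * (p : ℝ) ^ (δ * (ε / 2))) (j : ℕ) :
    (p : ℝ) ^ (3 - 1 / 5 : ℝ) ≤ (B ^ 3 ^ j).card ∨
      (p : ℝ) ^ (δ * (1 + ε / 2) ^ j) ≤ (B ^ 3 ^ j).card := by
  have hp1 : (1 : ℝ) ≤ p := by exact_mod_cast (Fact.out : p.Prime).one_lt.le
  have hp0 : (0 : ℝ) < p := by linarith
  have hmono : ∀ k l : ℕ, k ≤ l → ((B ^ k).card : ℝ) ≤ (B ^ l).card := fun k l h ↦ by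
    exact_mod_cast Finset.card_le_card (Finset.pow_subset_pow_right h1 h)
  induction j with
  | zero => right; simpa using hB
  | succ j ih =>
    have hstep : ((B ^ 3 ^ j).card : ℝ) ≤ (B ^ 3 ^ (j + 1)).card :=
      hmono _ _ (Nat.pow_le_pow_right (by norm_num) (Nat.le_succ j))
    by_cases hbig : (p : ℝ) ^ (3 - 1 / 5 : ℝ) ≤ (B ^ 3 ^ j).card
    · exact Or.inl (hbig.trans hstep)
    right
    have ih := ih.resolve_left hbig
    have hsub : B ⊆ B ^ 3 ^ j := by
      have := Finset.pow_subset_pow_right h1 (Nat.one_le_pow j 3 (by norm_num))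
      rwa [pow_one] at this
    have hg := hgrow (B ^ 3 ^ j) (by
      rw [eq_top_iff, ← hgen]
      exact Subgroup.closure_mono (Finset.coe_subset.2 hsub)) ⟨1, hsub h1⟩ (not_le.1 hbig)
    rw [← pow_mul, ← pow_succ] at hg
    have hlow : (p : ℝ) ^ δ ≤ (B ^ 3 ^ j).card :=
      hB.trans (by exact_mod_cast Finset.card_le_card hsub)
    refine le_trans ?_ hg.le
    generalize ((B ^ 3 ^ j).card : ℝ) = a at ih hlow
    have hc : 0 < c := by
      by_contra h
      have : c * (p : ℝ) ^ (δ * (ε / 2)) ≤ 0 :=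
        mul_nonpos_of_nonpos_of_nonneg (not_lt.1 h) (by positivity)
      linarith
    have ha : 0 < a := lt_of_lt_of_le (by positivity) hlow
    have h3 : 1 ≤ c * a ^ (ε / 2) := by
      refine hp.trans ?_
      rw [Real.rpow_mul hp0.le]
      gcongr
    calc (p : ℝ) ^ (δ * (1 + ε / 2) ^ (j + 1))
        = ((p : ℝ) ^ (δ * (1 + ε / 2) ^ j)) ^ (1 + ε / 2) := by
          rw [← Real.rpow_mul hp0.le]
          congr 1
          ring
      _ ≤ a ^ (1 + ε / 2) := by gcongr
      _ = 1 * a ^ (1 + ε / 2) := (one_mul _).symm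
      _ ≤ (c * a ^ (ε / 2)) * a ^ (1 + ε / 2) := by gcongr
      _ = c * a ^ (1 + ε) := by
          rw [mul_assoc, ← Real.rpow_add ha]
          congr 2
          ring

set_option maxRecDepth 4000 in
theorem exists_pow_eq_univ {δ : ℝ} (hδ : 0 < δ) : ∃ k : ℕ, 0 < k ∧
    ∀ (p : ℕ) [Fact p.Prime] (B : Finset SL(2, ZMod p)), 1 ∈ B → B⁻¹ = B →
      Subgroup.closure (B : Set SL(2, ZMod p)) = ⊤ → (p : ℝ) ^ δ ≤ B.card → ∀ g, g ∈ B ^ k := by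
  obtain ⟨c, hc, ε, hε, hgrow⟩ := exists_growth_constants (δ := 1 / 5) (by norm_num)
  obtain ⟨J, hJ⟩ : ∃ J : ℕ, 3 / δ < (1 + ε / 2) ^ J :=
    pow_unbounded_of_one_lt _ (by linarith)
  obtain ⟨P, hP⟩ : ∃ P : ℕ, ∀ p : ℕ, P < p → 1 ≤ c * (p : ℝ) ^ (δ * (ε / 2)) := by
    have ht : Filter.Tendsto (fun p : ℕ ↦ c * (p : ℝ) ^ (δ * (ε / 2))) Filter.atTop Filter.atTop :=
      ((tendsto_rpow_atTop (by positivity)).comp tendsto_natCast_atTop_atTop).const_mul_atTop hc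
    obtain ⟨P, hP⟩ := Filter.eventually_atTop.1 (ht.eventually_ge_atTop 1)
    exact ⟨P, fun p hp ↦ hP p hp.le⟩
  -- Beyond `P` the constant `c` is absorbed, and beyond `2 ^ 20` one has `p ^ (1/5) > 16`, so size
  -- `p ^ (14/5)` passes the threshold `16 * p ^ 11` for fourth powers. For `p ≤ Q` the order of the
  -- group is at most `Q ^ 4`, which bounds the number of factors.
  set Q := max P (2 ^ 20) with hQ
  refine ⟨max (3 ^ J * 48) (Q ^ 4), lt_max_of_lt_left (by positivity), ?_⟩
  intro p hp B h1 hinv hgen hB g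
  by_cases hpQ : p ≤ Q
  · refine Finset.pow_subset_pow_right h1 ?_ (mem_pow_card_of_closure_eq_top h1 hinv hgen g)
    exact (card_specialLinearGroup_le p).trans
      ((Nat.pow_le_pow_left hpQ 4).trans (le_max_right _ _))
  · have hpQ : Q < p := not_le.1 hpQ
    have hp1 : (1 : ℝ) ≤ p := by exact_mod_cast hp.out.one_lt.le
    have hp0 : (0 : ℝ) < p := by linarith
    refine Finset.pow_subset_pow_right h1 (le_max_left (3 ^ J * 48) (Q ^ 4)) ?_
    rw [pow_mul]
    have hbig : (p : ℝ) ^ (3 - 1 / 5 : ℝ) ≤ (B ^ 3 ^ J).card := by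
      rcases le_card_pow_three_pow h1 hgen hε (hgrow p) hB
        (hP p ((le_max_left _ _).trans_lt hpQ)) J with h | h
      · exact h
      · refine le_trans (Real.rpow_le_rpow_of_exponent_le hp1 ?_) h
        rw [div_lt_iff₀ hδ] at hJ
        linarith
    have hone : 1 ∈ B ^ 3 ^ J := Finset.one_mem_pow h1
    have hinvJ : (B ^ 3 ^ J)⁻¹ = B ^ 3 ^ J := by rw [← inv_pow, hinv]
    generalize B ^ 3 ^ J = D at hbig hone hinvJ ⊢
    suffices hD : 16 * Fintype.card (ZMod p) ^ 11 < D.card ^ 4 from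
      pow_eq_univ_of_card hone hinvJ hD g
    rw [ZMod.card]
    have hp20 : (2 : ℝ) ^ 20 < p := by
      exact_mod_cast (le_max_right P (2 ^ 20)).trans_lt hpQ
    have h16 : (16 : ℝ) < (p : ℝ) ^ (1 / 5 : ℝ) := by
      calc (16 : ℝ) = ((2 : ℝ) ^ 20) ^ (1 / 5 : ℝ) := by
            rw [← Real.rpow_natCast, ← Real.rpow_mul (by norm_num)]
            norm_num
        _ < (p : ℝ) ^ (1 / 5 : ℝ) := by gcongr
    have hreal : 16 * (p : ℝ) ^ 11 < (D.card : ℝ) ^ 4 := by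
      calc 16 * (p : ℝ) ^ 11 < (p : ℝ) ^ (1 / 5 : ℝ) * (p : ℝ) ^ 11 := by gcongr
        _ = ((p : ℝ) ^ (3 - 1 / 5 : ℝ)) ^ 4 := by
            rw [← Real.rpow_natCast, ← Real.rpow_natCast, ← Real.rpow_mul hp0.le,
              ← Real.rpow_add hp0]
            norm_num
        _ ≤ (D.card : ℝ) ^ 4 := by gcongr
    exact_mod_cast hreal

end Generation

/-! ### The main theorem. -/

theorem mainTheorem2 :
    (∀ δ : ℝ, 0 < δ → ∃ c : ℝ, 0 < c ∧ ∃ ε : ℝ, 0 < ε ∧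
      ∀ (p : ℕ) [Fact p.Prime] (A : Set (Matrix.SpecialLinearGroup (Fin 2) (ZMod p))),
        (∀ H : Subgroup (Matrix.SpecialLinearGroup (Fin 2) (ZMod p)),
          A ⊆ (H : Set (Matrix.SpecialLinearGroup (Fin 2) (ZMod p))) → H = ⊤) →
        (A.ncard : ℝ) < (p : ℝ) ^ (3 - δ) →
        c * (A.ncard : ℝ) ^ (1 + ε) < ((A * A * A).ncard : ℝ)) ∧
    (∀ δ : ℝ, 0 < δ → ∃ k : ℕ, 0 < k ∧
      ∀ (p : ℕ) [Fact p.Prime] (A : Set (Matrix.SpecialLinearGroup (Fin 2) (ZMod p))),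
        (∀ H : Subgroup (Matrix.SpecialLinearGroup (Fin 2) (ZMod p)),
          A ⊆ (H : Set (Matrix.SpecialLinearGroup (Fin 2) (ZMod p))) → H = ⊤) →
        (p : ℝ) ^ δ < (A.ncard : ℝ) →
        ∀ g : Matrix.SpecialLinearGroup (Fin 2) (ZMod p),
          ∃ l : List (Matrix.SpecialLinearGroup (Fin 2) (ZMod p)),
            l.length ≤ k ∧ (∀ x ∈ l, x ∈ A ∪ A⁻¹) ∧ l.prod = g) := by
  constructor
  · intro δ hδ
    obtain ⟨c, hc, ε, hε, h⟩ := exists_growth_constants hδ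
    refine ⟨c, hc, ε, hε, fun p _ A hA hcard ↦ ?_⟩
    lift A to Finset SL(2, ZMod p) using A.toFinite
    have hgen := hA _ Subgroup.subset_closure
    -- A generating set must move the line of some vector, so it is not empty.
    have hne : A.Nonempty := by
      obtain ⟨g, hg, -⟩ := exists_not_eigenvector hgen (w := 1) one_ne_zero
      exact ⟨g, hg⟩
    rw [Set.ncard_coe_finset] at hcard ⊢
    have := h p A hgen hne hcard
    rwa [← Finset.coe_mul, ← Finset.coe_mul, Set.ncard_coe_finset, ← sq, ← pow_succ]
  · intro δ hδ
    obtain ⟨k, hk, h⟩ := exists_pow_eq_univ hδ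
    refine ⟨k, hk, fun p _ A hA hcard g ↦ ?_⟩
    lift A to Finset SL(2, ZMod p) using A.toFinite
    have hgen := hA _ Subgroup.subset_closure
    rw [Set.ncard_coe_finset] at hcard
    have hsub : A ⊆ insert 1 (A ∪ A⁻¹) :=
      Finset.subset_union_left.trans (Finset.subset_insert _ _)
    have hg := h p (insert 1 (A ∪ A⁻¹)) (Finset.mem_insert_self _ _)
      (by rw [Finset.inv_insert, inv_one, union_inv_inv])
      (by
        rw [eq_top_iff, ← hgen]
        exact Subgroup.closure_mono (Finset.coe_subset.2 hsub))
      (hcard.le.trans (by exact_mod_cast Finset.card_le_card hsub)) g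
    obtain ⟨j, hj, hgj⟩ := mem_pow_of_mem_insert_one_pow hg
    obtain ⟨l, hl, hlA, hprod⟩ := exists_list_of_mem_pow hgj
    refine ⟨l, hl.le.trans hj, fun x hx ↦ ?_, hprod⟩
    have := hlA x hx
    rwa [← Finset.mem_coe, Finset.coe_union, Finset.coe_inv] at this
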